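/- Let $D$ be a connected smooth surface and let $S:TD\to TD$ be a smooth endomorphism field that is pointwise diagonalizable with smooth eigenvalue functions $A,B$, $A\neq B$ everywhere. At each point let $\mathbf a,\mathbf b$ be a basis of eigenvectors with dual basis $\alpha,\beta$, so that $S=A\,\mathbf a\otimes\alpha+B\,\mathbf b\otimes\beta$, and for a smooth function $f$ write $df=d'f+d''f$ with $d'f$ a multiple of $\alpha$ and $d''f$ a multiple of $\beta$. Assume that $S$ is invertible ($A$ and $B$ vanish nowhere) and nondegenerate ($d''A$ and $d'B$ vanish nowhere), and put $$\theta_1=\frac{A\,d'B}{B(B-A)},\qquad \theta_2=\frac{B\,d''A}{A(A-B)}.$$ Assume that $S$ is of Type I in the sense that there are functions $K_2,K_{21}$ on $D$, with $K_2$ smooth, such that $$d\theta_1=\theta_1\wedge\theta_2,\qquad d\theta_2=K_2\,\theta_2\wedge\theta_1,\qquad dK_2=K_{21}\,\theta_1+2(K_2-1)\,\theta_2 .$$ Let $R\subset D$ be a connected nonempty open subset and let $(\mathbf x,\mathbf n)$ be a normally oriented realization of $S$ on $R$: $\mathbf x:R\to\mathbb R^3$ is a smooth immersion, $\mathbf n:R\to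 S^2$ is a smooth map with $\mathbf n\cdot d\mathbf x=0$, and the forms $\mathrm I=d\mathbf x\cdot d\mathbf x$ and $\mathrm{II}=-d\mathbf n\cdot d\mathbf x$ satisfy $\mathrm{II}(v,w)=\mathrm I(v,Sw)$. Then for every principal curve of the second family in $R$ (a connected integral curve of $\theta_1=0$), its Gauss image, i.e. its image under $\mathbf n$, is an arc of a geodesic circle on $S^2$ (a connected subset with more than one point of $\{q\in S^2: d_{S^2}(c,q)=r\}$ for some $c\in S^2$, $0<r<\pi$). Moreover, there is a single great circle on $S^2$ that contains the spherical centers $c$ of the geodesic circles so obtained from all the principal curves of the second family in $R$. -/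

import Mathlib

open scoped Manifold ContDiff RealInnerProductSpace Topology
open Bundle Set

noncomputable section

/-- The coordinate plane on which surfaces are modelled. -/
abbrev Plane : Type := EuclideanSpace ℝ (Fin 2)

/-- Euclidean three-space. -/
abbrev E3 : Type := EuclideanSpace ℝ (Fin 3)

namespace ShapeOp

section Forms

variable {D : Type*} [TopologicalSpace D] [ChartedSpace Plane D]

/-- The differential `df` at `p` of a map from a surface to a normed space, as a linear map on the
tangent plane at `p`. -/
def differential {F : Type*} [NormedAddCommGroup F] [NormedSpace ℝ F] (f : D → F) (p : D) :
    TangentSpace (𝓡 2) p →L[ℝ] F :=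
  mfderiv (𝓡 2) 𝓘(ℝ, F) f p

variable (D) in
/-- Fields of endomorphisms `S : TD → TD` of the tangent bundle of the surface `D`. -/
abbrev EndField : Type _ := (p : D) → TangentSpace (𝓡 2) p →L[ℝ] TangentSpace (𝓡 2) p

variable (D) in
/-- Fields of linear forms on the tangent planes of the surface `D`, that is, 1-forms. -/
abbrev OneForm : Type _ := (p : D) → TangentSpace (𝓡 2) p →L[ℝ] ℝ

/-- The wedge product of two 1-forms. -/
def wedge (φ ψ : OneForm D) (p : D) (v w : TangentSpace (𝓡 2) p) : ℝ :=
  φ p v * ψ p w - φ p w * ψ p v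

/-- The differential of the inverse of a chart `e` at the coordinate point `u`. -/
def chartFrame (e : OpenPartialHomeomorph D Plane) (u : Plane) :
    Plane →L[ℝ] TangentSpace (𝓡 2) (e.symm u) :=
  mfderiv 𝓘(ℝ, Plane) (𝓡 2) e.symm u

/-- The coordinate expression of the 1-form `φ` in the chart `e`, i.e. its pull-back by `e.symm`. -/
def inChart (e : OpenPartialHomeomorph D Plane) (φ : OneForm D) (u : Plane) :
    Plane [⋀^Fin 1]→L[ℝ] ℝ :=
  ContinuousAlternatingMap.ofSubsingleton ℝ Plane ℝ (0 : Fin 1)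
    ((φ (e.symm u)).comp (chartFrame e u))

/-- `dφ = Φ` on the surface: in every chart the coordinate expression of the 1-form `φ` is
differentiable and its exterior derivative is the coordinate expression of the 2-form `Φ`. -/
def HasExtDeriv (φ : OneForm D)
    (Φ : (p : D) → TangentSpace (𝓡 2) p → TangentSpace (𝓡 2) p → ℝ) : Prop :=
  ∀ e ∈ atlas Plane D, ∀ u ∈ e.target,
    DifferentiableAt ℝ (inChart e φ) u ∧
    ∀ v w : Plane, extDeriv (inChart e φ) u ![v, w]
      = Φ (e.symm u) (chartFrame e u v) (chartFrame e u w)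

end Forms

section Operators

variable {D : Type*} [TopologicalSpace D] [ChartedSpace Plane D]

/-- `S` is a smooth field of endomorphisms, and `A ≠ B` are smooth functions such that every tangent
plane has a basis `a, b` with `S a = A a` and `S b = B b`; in terms of the dual basis `α, β` this
says `S = A a ⊗ α + B b ⊗ β`, with the `A`-eigenline first and the `B`-eigenline second. -/
structure IsDiagonalizedBy [IsManifold (𝓡 2) ∞ D] (S : EndField D) (A B : D → ℝ) : Prop where
  smooth_S : ContMDiff (𝓡 2) ((𝓡 2).prod 𝓘(ℝ, Plane →L[ℝ] Plane)) ∞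
    (fun p => TotalSpace.mk' (Plane →L[ℝ] Plane)
      (E := fun p : D => TangentSpace (𝓡 2) p →L[ℝ] TangentSpace (𝓡 2) p) p (S p))
  smooth_A : ContMDiff (𝓡 2) 𝓘(ℝ, ℝ) ∞ A
  smooth_B : ContMDiff (𝓡 2) 𝓘(ℝ, ℝ) ∞ B
  ne : ∀ p, A p ≠ B p
  eigenbasis : ∀ p, ∃ a b : TangentSpace (𝓡 2) p, LinearIndependent ℝ ![a, b] ∧
    S p a = A p • a ∧ S p b = B p • b

/-- The projection `a ⊗ α` of the tangent plane onto the `A`-eigenline of `S` along the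
`B`-eigenline. -/
def proj₁ (S : EndField D) (A B : D → ℝ) : EndField D := fun p =>
  (A p - B p)⁻¹ • (S p - B p • ContinuousLinearMap.id ℝ (TangentSpace (𝓡 2) p))

/-- The projection `b ⊗ β` of the tangent plane onto the `B`-eigenline of `S` along the
`A`-eigenline. -/
def proj₂ (S : EndField D) (A B : D → ℝ) : EndField D := fun p =>
  (B p - A p)⁻¹ • (S p - A p • ContinuousLinearMap.id ℝ (TangentSpace (𝓡 2) p))

/-- The component `d' f` of `df` that is a multiple of `α`. -/
def d' (S : EndField D) (A B f : D → ℝ) : OneForm D := fun p =>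
  (differential f p).comp (proj₁ S A B p)

/-- The component `d'' f` of `df` that is a multiple of `β`. -/
def d'' (S : EndField D) (A B f : D → ℝ) : OneForm D := fun p =>
  (differential f p).comp (proj₂ S A B p)

/-- The (diagonalized) operator is nondegenerate: `d'' A` and `d' B` vanish nowhere. -/
def IsNondegenerate (S : EndField D) (A B : D → ℝ) : Prop :=
  ∀ p, d'' S A B A p ≠ 0 ∧ d' S A B B p ≠ 0

/-- The (diagonalized) operator is invertible: its eigenvalues vanish nowhere. -/
def IsInvertible (A B : D → ℝ) : Prop :=
  ∀ p, A p ≠ 0 ∧ B p ≠ 0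

/-- The 1-form `θ₁ = A d'B / (B (B - A))`. -/
def θ₁ (S : EndField D) (A B : D → ℝ) : OneForm D := fun p =>
  (A p / (B p * (B p - A p))) • d' S A B B p

/-- The 1-form `θ₂ = B d''A / (A (A - B))`. -/
def θ₂ (S : EndField D) (A B : D → ℝ) : OneForm D := fun p =>
  (B p / (A p * (A p - B p))) • d'' S A B A p

/-- The first system of structure equations of Type I for a coframing `(φ₁, φ₂)`: there are
functions `K₂`, `K₂₁` with `dφ₁ = φ₁ ∧ φ₂`, `dφ₂ = K₂ φ₂ ∧ φ₁` and
`dK₂ = K₂₁ φ₁ + 2 (K₂ - 1) φ₂`. -/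
def FirstSystem (φ₁ φ₂ : OneForm D) : Prop :=
  ∃ K₂ K₂₁ : D → ℝ, ContMDiff (𝓡 2) 𝓘(ℝ, ℝ) ∞ K₂ ∧
    HasExtDeriv φ₁ (wedge φ₁ φ₂) ∧
    HasExtDeriv φ₂ (fun p v w => K₂ p * wedge φ₂ φ₁ p v w) ∧
    ∀ p, differential K₂ p = K₂₁ p • φ₁ p + (2 * (K₂ p - 1)) • φ₂ p

end Operators

section Surfaces

variable {D : Type*} [TopologicalSpace D] [ChartedSpace Plane D]

/-- The first fundamental form `I = dx · dx`. -/
def firstForm (x : D → E3) (p : D) (v w : TangentSpace (𝓡 2) p) : ℝ :=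
  ⟪differential x p v, differential x p w⟫

/-- The second fundamental form `II = - dn · dx`. -/
def secondForm (x n : D → E3) (p : D) (v w : TangentSpace (𝓡 2) p) : ℝ :=
  -⟪differential n p v, differential x p w⟫

/-- `(x, n)` is on the open set `R` a smooth normally oriented immersion into Euclidean space whose
Weingarten operator, defined by `II(v, w) = I(v, S w)`, is `S`. -/
structure IsRealizationOn (S : EndField D) (R : Set D) (x n : D → E3) : Prop where
  smooth_x : ContMDiffOn (𝓡 2) 𝓘(ℝ, E3) ∞ x R
  smooth_n : ContMDiffOn (𝓡 2) 𝓘(ℝ, E3) ∞ n R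
  immersion : ∀ p ∈ R, Function.Injective (differential x p)
  unit : ∀ p ∈ R, ‖n p‖ = 1
  normal : ∀ p ∈ R, ∀ v, ⟪n p, differential x p v⟫ = 0
  shape : ∀ p ∈ R, ∀ v w, secondForm x n p v w = firstForm x p v (S p w)

/-- `γ`, restricted to the nonempty open interval `J`, is a smooth regular parametrization of a
connected integral curve in `R` of the equation `φ = 0`. -/
structure IsIntegralCurveOf (φ : OneForm D) (R : Set D) (γ : ℝ → D) (J : Set ℝ) : Prop where
  isOpen : IsOpen J
  isConnected : IsConnected J
  mapsTo : MapsTo γ J R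
  smooth : ContMDiffOn 𝓘(ℝ, ℝ) (𝓡 2) ∞ γ J
  regular : ∀ t ∈ J, mfderiv 𝓘(ℝ, ℝ) (𝓡 2) γ t (1 : ℝ) ≠ 0
  tangent : ∀ t ∈ J, φ (γ t) (mfderiv 𝓘(ℝ, ℝ) (𝓡 2) γ t (1 : ℝ)) = 0

end Surfaces

section Sphere

/-- The geodesic circle on the unit sphere with spherical center `c` and spherical radius `r`. -/
def geodesicCircle (c : E3) (r : ℝ) : Set E3 :=
  {q | ‖q‖ = 1 ∧ InnerProductGeometry.angle c q = r}

/-- `Γ` is an arc (a connected subset with more than one point) of the geodesic circle on the unit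
sphere with spherical center `c` and spherical radius `r`. -/
def IsArcOfGeodesicCircle (Γ : Set E3) (c : E3) (r : ℝ) : Prop :=
  ‖c‖ = 1 ∧ r ∈ Ioo 0 Real.pi ∧ Γ ⊆ geodesicCircle c r ∧ IsConnected Γ ∧ Γ.Nontrivial

/-- The great circle on the unit sphere that is perpendicular to `N`. -/
def greatCircle (N : E3) : Set E3 :=
  {q | ‖q‖ = 1 ∧ ⟪N, q⟫ = 0}

end Sphere

end ShapeOp

end

/-! Let `V`, `W` be the frame of eigenvector fields dual to `(θ₁, θ₂)`, and write `K` for `K₂`. The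
definitions of `θ₁` and `θ₂` become formulas for `V B` and `W A`. By Cartan's formula the first two
structure equations say `[V, W] = -V + K W` (`dAlong_bracket`), and the third gives `W K = 2 (K -
1)`.

In a realization `V n = -A V x` and `W n = -B W x`. Comparing the commutators on `x` and on `n`
yields `W V n = -W n` and `V W n = -V n + (K - 1) W n`. From here on only `n` matters
(`IsGaussFrameOn`).

Circles: `C = n + V n` satisfies `W C = 0`, so it is constant along each principal curve of the
second family. Since `⟪C, n⟫ = 1` and `‖C‖ > 1`, the Gauss image lies in a plane section of the
sphere with center `C / ‖C‖`.

Common great circle: `M = W n + W W n` is orthogonal to every such center, because differentiating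
`⟪c, n⟫ = const` gives `c ⟂ W n` and `c ⟂ W W n`. It remains to see that `M` has constant direction.
The bracket relation and `W K = 2 (K - 1)` give `V M = (2 K - 1) M` (`dV_axisVector`). Moreover `M`
and `W M` are both orthogonal to the independent vectors `C` and `V C`, so `W M` is a multiple of
`M` (`exists_dW_axisVector`). As `R` is connected, `M / ‖M‖` is constant (`exists_const_direction`),
and it is the normal of the great circle. -/

noncomputable section

namespace ShapeOp

/-! ### Differentiation of vector-valued functions on the surface -/

section Calculus

variable {D : Type*} [TopologicalSpace D] [ChartedSpace Plane D]
variable {F G H : Type*} [NormedAddCommGroup F] [NormedSpace ℝ F] [NormedAddCommGroup G]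
  [NormedSpace ℝ G] [NormedAddCommGroup H] [NormedSpace ℝ H]

variable (D) in
/-- Vector fields on the surface `D`. -/
abbrev VField : Type _ := (p : D) → TangentSpace (𝓡 2) p

/-- The derivative of `f` along the vector field `V`. -/
def dAlong (V : VField D) (f : D → F) : D → F := fun p => differential f p (V p)

/-- Smoothness of a vector field at a point. -/
def SmoothFieldAt [IsManifold (𝓡 2) ∞ D] (V : VField D) (p : D) : Prop :=
  ContMDiffAt (𝓡 2) (𝓡 2).tangent ∞
    (fun q => (TotalSpace.mk' Plane q (V q) : TangentBundle (𝓡 2) D)) p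

theorem ContMDiffAt.dAlong [IsManifold (𝓡 2) ∞ D] {V : VField D} {f : D → F} {p : D}
    (hV : SmoothFieldAt V p) (hf : ContMDiffAt (𝓡 2) 𝓘(ℝ, F) ∞ f p) :
    ContMDiffAt (𝓡 2) 𝓘(ℝ, F) ∞ (dAlong V f) p := by
  have hφ := hf.mfderiv_const (m := ∞) (by simp)
  have h := ContMDiffAt.clm_apply_of_inCoordinates (b₁ := id) (b₂ := f)
    (ϕ := fun q => mfderiv (𝓡 2) 𝓘(ℝ, F) f q) (v := V) (m₀ := p)
    (E₁ := fun q : D => TangentSpace (𝓡 2) q) (E₂ := fun q : F => TangentSpace 𝓘(ℝ, F) q)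
    hφ hV hf
  exact (contMDiff_snd_tangentBundle_modelSpace F 𝓘(ℝ, F)).contMDiffAt.comp p h

theorem differential_bilinear (Φ : F →L[ℝ] G →L[ℝ] H) {f : D → F} {g : D → G} {p : D}
    (hf : MDifferentiableAt (𝓡 2) 𝓘(ℝ, F) f p) (hg : MDifferentiableAt (𝓡 2) 𝓘(ℝ, G) g p)
    (v : TangentSpace (𝓡 2) p) :
    differential (fun q => Φ (f q) (g q)) p v =
      Φ (f p) (differential g p v) + Φ (differential f p v) (g p) := by
  have h : HasMFDerivAt (𝓡 2) 𝓘(ℝ, H) (fun q => Φ (f q) (g q)) p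
      (Φ.precompR Plane (f p) (differential g p : Plane →L[ℝ] G) +
        Φ.precompL Plane (differential f p : Plane →L[ℝ] F) (g p)) := by
    refine ⟨Φ.continuous₂.continuousAt.comp (hf.continuousAt.prodMk hg.continuousAt), ?_⟩
    have := Φ.hasFDerivWithinAt_of_bilinear hf.hasMFDerivAt.2 hg.hasMFDerivAt.2
    simp only [writtenInExtChartAt, Function.comp_apply,
      mfld_simps] at this ⊢
    exact this
  exact congrArg (fun L => L v) h.mfderiv

theorem differential_inner {f g : D → E3} {p : D}
    (hf : MDifferentiableAt (𝓡 2) 𝓘(ℝ, E3) f p) (hg : MDifferentiableAt (𝓡 2) 𝓘(ℝ, E3) g p)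
    (v : TangentSpace (𝓡 2) p) :
    differential (fun q => ⟪f q, g q⟫) p v =
      ⟪f p, differential g p v⟫ + ⟪differential f p v, g p⟫ :=
  differential_bilinear (innerSL ℝ) hf hg v

theorem differential_smul {f : D → ℝ} {g : D → F} {p : D}
    (hf : MDifferentiableAt (𝓡 2) 𝓘(ℝ, ℝ) f p) (hg : MDifferentiableAt (𝓡 2) 𝓘(ℝ, F) g p)
    (v : TangentSpace (𝓡 2) p) :
    differential (fun q => f q • g q) p v =
      f p • differential g p v + differential f p v • g p :=
  differential_bilinear (ContinuousLinearMap.lsmul ℝ ℝ) hf hg v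

theorem differential_add {f g : D → F} {p : D}
    (hf : MDifferentiableAt (𝓡 2) 𝓘(ℝ, F) f p) (hg : MDifferentiableAt (𝓡 2) 𝓘(ℝ, F) g p)
    (v : TangentSpace (𝓡 2) p) :
    differential (fun q => f q + g q) p v = differential f p v + differential g p v :=
  congrArg (fun L => L v) (hf.hasMFDerivAt.add hg.hasMFDerivAt).mfderiv

theorem differential_const (c : F) (p : D) (v : TangentSpace (𝓡 2) p) :
    differential (fun _ : D => c) p v = 0 :=
  congrArg (fun L => L v) (mfderiv_const (I := 𝓡 2) (I' := 𝓘(ℝ, F)) (c := c) (x := p))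

theorem differential_congr {f g : D → F} {p : D} (h : f =ᶠ[𝓝 p] g) :
    differential f p = differential g p := h.mfderiv_eq

theorem differential_symm_comp {e : OpenPartialHomeomorph D Plane} [IsManifold (𝓡 2) ∞ D]
    (he : e ∈ atlas Plane D)
    {f : D → F} {u : Plane} (hu : u ∈ e.target)
    (hf : MDifferentiableAt (𝓡 2) 𝓘(ℝ, F) f (e.symm u)) (v : Plane) :
    fderiv ℝ (f ∘ e.symm) u v = differential f (e.symm u) (chartFrame e u v) := by
  have : IsManifold (𝓡 2) 1 D := .of_le (n := ∞) (by simp)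
  have h1 := mfderiv_comp u hf (mdifferentiableAt_atlas_symm (I := 𝓡 2) he hu)
  have h2 := congrArg (fun L => L v) h1
  rw [← mfderiv_eq_fderiv]
  exact h2

end Calculus

/-! ### Commutators of derivatives along a frame, via charts -/

section Bracket

variable {D : Type*} [TopologicalSpace D] [ChartedSpace Plane D] [IsManifold (𝓡 2) ∞ D]
variable {F : Type*} [NormedAddCommGroup F] [NormedSpace ℝ F]

/-- The coordinate expression of a vector field in a chart. -/
def fieldInChart (e : OpenPartialHomeomorph D Plane) (V : VField D) : Plane → Plane :=
  dAlong V e ∘ e.symm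

theorem chartFrame_fieldInChart {e : OpenPartialHomeomorph D Plane} (he : e ∈ atlas Plane D)
    (V : VField D) {u : Plane} (hu : u ∈ e.target) :
    chartFrame e u (fieldInChart e V u) = V (e.symm u) := by
  have : IsManifold (𝓡 2) 1 D := .of_le (n := ∞) (by simp)
  have h := (mdifferentiable_of_mem_atlas (I := 𝓡 2) he).symm_comp_deriv (e.map_target hu)
  rw [e.right_inv hu] at h
  exact congrArg (fun L => L (V (e.symm u))) h

theorem dAlong_comp_symm {e : OpenPartialHomeomorph D Plane} (he : e ∈ atlas Plane D)
    (V : VField D) {f : D → F} {u : Plane} (hu : u ∈ e.target)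
    (hf : MDifferentiableAt (𝓡 2) 𝓘(ℝ, F) f (e.symm u)) :
    dAlong V f (e.symm u) = fderiv ℝ (f ∘ e.symm) u (fieldInChart e V u) := by
  rw [differential_symm_comp he hu hf, chartFrame_fieldInChart he V hu]; rfl

theorem contDiffAt_comp_symm {e : OpenPartialHomeomorph D Plane} (he : e ∈ atlas Plane D)
    {f : D → F} {u : Plane} (hu : u ∈ e.target)
    (hf : ContMDiffAt (𝓡 2) 𝓘(ℝ, F) ∞ f (e.symm u)) : ContDiffAt ℝ ∞ (f ∘ e.symm) u := by
  have h1 : ContMDiffAt 𝓘(ℝ, Plane) (𝓡 2) ∞ e.symm u :=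
    (contMDiffOn_symm_of_mem_maximalAtlas (I := 𝓡 2)
      (IsManifold.subset_maximalAtlas he)).contMDiffAt (e.open_target.mem_nhds hu)
  exact (hf.comp u h1).contDiffAt

theorem contDiffAt_fieldInChart {e : OpenPartialHomeomorph D Plane} (he : e ∈ atlas Plane D)
    {V : VField D} {u : Plane} (hu : u ∈ e.target) (hV : SmoothFieldAt V (e.symm u)) :
    ContDiffAt ℝ ∞ (fieldInChart e V) u := by
  refine contDiffAt_comp_symm he hu (ContMDiffAt.dAlong hV ?_)
  exact (contMDiffOn_of_mem_maximalAtlas (I := 𝓡 2)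
      (IsManifold.subset_maximalAtlas he)).contMDiffAt (e.open_source.mem_nhds (e.map_target hu))

/-- This is Cartan's formula `dφ(V, W) = V φ(W) - W φ(V) - φ([V, W])`, whose first two terms vanish
because `φ(V)` and `φ(W)` are locally constant. -/
theorem extDeriv_ofSubsingleton {φ : Plane → Plane →L[ℝ] ℝ} {u : Plane}
    (hφ : DifferentiableAt ℝ
      (fun u => ContinuousAlternatingMap.ofSubsingleton ℝ Plane ℝ (0 : Fin 1) (φ u)) u)
    {V W : Plane → Plane} (hV : DifferentiableAt ℝ V u) (hW : DifferentiableAt ℝ W u)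
    {a b : ℝ} (ha : ∀ᶠ u' in 𝓝 u, φ u' (V u') = a) (hb : ∀ᶠ u' in 𝓝 u, φ u' (W u') = b) :
    extDeriv (fun u => ContinuousAlternatingMap.ofSubsingleton ℝ Plane ℝ (0 : Fin 1) (φ u)) u
      ![V u, W u] = - φ u (fderiv ℝ W u (V u) - fderiv ℝ V u (W u)) := by
  have hφ' : DifferentiableAt ℝ φ u := by
    exact ((ContinuousAlternatingMap.ofSubsingletonLIE (ι := Fin 1) (𝕜 := ℝ) (E := Plane) (F := ℝ)
      0).symm.toContinuousLinearEquiv.differentiableAt).comp u hφ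
  have key : ∀ {W : Plane → Plane} {b : ℝ}, DifferentiableAt ℝ W u →
      (∀ᶠ u' in 𝓝 u, φ u' (W u') = b) → ∀ v, fderiv ℝ φ u v (W u) = - φ u (fderiv ℝ W u v) := by
    intro W b hW hb v
    have h1 := fderiv_clm_apply hφ' hW
    have h2 : fderiv ℝ (fun y => (φ y) (W y)) u = 0 := by
      rw [Filter.EventuallyEq.fderiv_eq (f := fun _ => b) hb]; simp
    rw [h2] at h1
    have := congrArg (fun L => L v) h1
    simp at this
    linarith
  have h3 : ∀ w v : Plane, fderiv ℝ (fun y => φ y w) u v = fderiv ℝ φ u v w := by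
    intro w v
    rw [fderiv_clm_apply hφ' (differentiableAt_const _)]; simp
  have h4 : extDeriv
      (fun u => ContinuousAlternatingMap.ofSubsingleton ℝ Plane ℝ (0 : Fin 1) (φ u)) u ![V u, W u]
      = fderiv ℝ φ u (V u) (W u) - fderiv ℝ φ u (W u) (V u) := by
    rw [extDeriv_apply hφ, Fin.sum_univ_two]
    simp [Fin.removeNth, h3, sub_eq_add_neg]
  rw [h4, key hW hb, key hV ha, map_sub]
  ring

/-- The bracket of a frame `(V, W)` dual to a coframe `(φ₁, φ₂)` is determined by the exterior
derivatives of the coframe. -/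
theorem dAlong_bracket {φ₁ φ₂ : OneForm D} {V W : VField D} {f : D → F} {p : D} {a b : ℝ}
    {Φ₁ Φ₂ : (p : D) → TangentSpace (𝓡 2) p → TangentSpace (𝓡 2) p → ℝ}
    (h₁ : HasExtDeriv φ₁ Φ₁) (h₂ : HasExtDeriv φ₂ Φ₂)
    (hV : ∀ q, SmoothFieldAt V q) (hW : ∀ q, SmoothFieldAt W q)
    (h₁V : ∀ q, φ₁ q (V q) = 1) (h₁W : ∀ q, φ₁ q (W q) = 0)
    (h₂V : ∀ q, φ₂ q (V q) = 0) (h₂W : ∀ q, φ₂ q (W q) = 1)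
    (hspan : ∀ q v, v = φ₁ q v • V q + φ₂ q v • W q)
    (ha : Φ₁ p (V p) (W p) = a) (hb : Φ₂ p (V p) (W p) = b)
    (hf : ContMDiffAt (𝓡 2) 𝓘(ℝ, F) ∞ f p) :
    dAlong V (dAlong W f) p - dAlong W (dAlong V f) p = -(a • dAlong V f p) - b • dAlong W f p := by
  obtain ⟨e, he, u, hu, rfl⟩ : ∃ e ∈ atlas Plane D, ∃ u ∈ e.target, e.symm u = p :=
    ⟨chartAt Plane p, chart_mem_atlas Plane p, chartAt Plane p p,
      mem_chart_target Plane p, (chartAt Plane p).left_inv (mem_chart_source Plane p)⟩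
  have hV' := contDiffAt_fieldInChart he hu (hV _)
  have hW' := contDiffAt_fieldInChart he hu (hW _)
  have hf' := contDiffAt_comp_symm he hu hf
  have hVd : DifferentiableAt ℝ (fieldInChart e V) u := hV'.differentiableAt (by simp)
  have hWd : DifferentiableAt ℝ (fieldInChart e W) u := hW'.differentiableAt (by simp)
  have hfd : DifferentiableAt ℝ (fderiv ℝ (f ∘ e.symm)) u :=
    (hf'.fderiv_right (m := 1) (by norm_cast)).differentiableAt (by simp)
  have hev : ∀ᶠ u' in 𝓝 u, u' ∈ e.target ∧ MDifferentiableAt (𝓡 2) 𝓘(ℝ, F) f (e.symm u') := by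
    have hcont : ContinuousAt e.symm u := e.symm.continuousAt hu
    have h1 : ∀ᶠ q in 𝓝 (e.symm u), MDifferentiableAt (𝓡 2) 𝓘(ℝ, F) f q := by
      have : IsManifold (𝓡 2) 1 D := .of_le (n := ∞) (by simp)
      filter_upwards [(contMDiffAt_iff_contMDiffAt_nhds (by simp)).1
        (hf.of_le (m := 1) (by norm_cast))] with q hq
      exact hq.mdifferentiableAt (by simp)
    exact (e.open_target.mem_nhds hu |> Filter.eventually_of_mem <| fun _ h => h).and
      (hcont.eventually h1)
  have hdiff : ∀ {U : VField D}, SmoothFieldAt U (e.symm u) →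
      MDifferentiableAt (𝓡 2) 𝓘(ℝ, F) (dAlong U f) (e.symm u) := fun hU =>
    (ContMDiffAt.dAlong hU hf).mdifferentiableAt (by simp)
  have hsecond : ∀ {U U' : VField D}, SmoothFieldAt U' (e.symm u) →
      DifferentiableAt ℝ (fieldInChart e U') u →
      dAlong U (dAlong U' f) (e.symm u) =
        fderiv ℝ (fderiv ℝ (f ∘ e.symm)) u (fieldInChart e U u) (fieldInChart e U' u) +
        fderiv ℝ (f ∘ e.symm) u (fderiv ℝ (fieldInChart e U') u (fieldInChart e U u)) := by
    intro U U' hU' hUd'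
    rw [dAlong_comp_symm he U hu (hdiff hU')]
    have : (dAlong U' f ∘ e.symm) =ᶠ[𝓝 u]
        fun u' => fderiv ℝ (f ∘ e.symm) u' (fieldInChart e U' u') := by
      filter_upwards [hev] with u' hu'
      exact dAlong_comp_symm he U' hu'.1 hu'.2
    rw [this.fderiv_eq, fderiv_clm_apply hfd hUd']
    simp [add_comm]
  have hsymm : IsSymmSndFDerivAt ℝ (f ∘ e.symm) u :=
    hf'.isSymmSndFDerivAt (by rw [minSmoothness_of_isRCLikeNormedField]; norm_cast)
  -- Coordinates of the bracket: each coframe form takes constant values on `V` and `W`, so its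
  -- value on `[V, W]` is minus its exterior derivative on `(V, W)`.
  have key : ∀ {φ : OneForm D} {Φ : (p : D) → TangentSpace (𝓡 2) p → TangentSpace (𝓡 2) p → ℝ}
      {c d : ℝ}, HasExtDeriv φ Φ → (∀ q, φ q (V q) = c) → (∀ q, φ q (W q) = d) →
      φ (e.symm u) (chartFrame e u (fderiv ℝ (fieldInChart e W) u (fieldInChart e V u) -
        fderiv ℝ (fieldInChart e V) u (fieldInChart e W u))) =
        - Φ (e.symm u) (V (e.symm u)) (W (e.symm u)) := by
    intro φ Φ c d hφ hc hd
    obtain ⟨h1, h2⟩ := hφ e he u hu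
    have h3 := h2 (fieldInChart e V u) (fieldInChart e W u)
    rw [chartFrame_fieldInChart he V hu, chartFrame_fieldInChart he W hu] at h3
    have h4 := extDeriv_ofSubsingleton (φ := fun u => (φ (e.symm u)).comp (chartFrame e u)) h1
      hVd hWd (a := c) (b := d)
      (by
        filter_upwards [hev] with u' hu'
        rw [ContinuousLinearMap.comp_apply, chartFrame_fieldInChart he V hu'.1, hc])
      (by
        filter_upwards [hev] with u' hu'
        rw [ContinuousLinearMap.comp_apply, chartFrame_fieldInChart he W hu'.1, hd])
    rw [← h3]
    exact neg_eq_iff_eq_neg.mp h4.symm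
  have hbr := hspan _ (chartFrame e u (fderiv ℝ (fieldInChart e W) u (fieldInChart e V u) -
        fderiv ℝ (fieldInChart e V) u (fieldInChart e W u)))
  rw [key h₁ h₁V h₁W, key h₂ h₂V h₂W, ha, hb] at hbr
  -- The Hessian terms cancel by symmetry of the second derivative, leaving `df([V, W])`.
  rw [hsecond (hW _) hWd, hsecond (hV _) hVd, hsymm.eq (fieldInChart e V u)]
  have h5 := congrArg (differential f (e.symm u)) hbr
  rw [← differential_symm_comp he hu hev.self_of_nhds.2] at h5
  rw [add_sub_add_left_eq_sub, ← map_sub, h5, map_add, map_smul, map_smul, neg_smul, neg_smul,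
    sub_eq_add_neg]
  rfl

end Bracket

/-! ### The eigenvector frame dual to `(θ₁, θ₂)` -/

section Frame

variable {D : Type*} [TopologicalSpace D] [ChartedSpace Plane D]

theorem θ₂_eq_θ₁_swap (S : EndField D) (A B : D → ℝ) : θ₂ S A B = θ₁ S B A := rfl

/-- Coordinates of a tangent vector in a basis of the tangent plane. -/
theorem exists_coords {p : D} {a b : TangentSpace (𝓡 2) p} (h : LinearIndependent ℝ ![a, b])
    (v : TangentSpace (𝓡 2) p) : ∃ c d : ℝ, v = c • a + d • b := by
  have hfin : Module.finrank ℝ (TangentSpace (𝓡 2) p) = 2 := finrank_euclideanSpace_fin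
  have : FiniteDimensional ℝ (TangentSpace (𝓡 2) p) := inferInstanceAs (FiniteDimensional ℝ Plane)
  have hs := h.span_eq_top_of_card_eq_finrank' (by simp [hfin])
  have hv : v ∈ Submodule.span ℝ (Set.range ![a, b]) := hs ▸ Submodule.mem_top
  rw [Matrix.range_cons_cons_empty, Submodule.mem_span_pair] at hv
  obtain ⟨c, d, h⟩ := hv
  exact ⟨c, d, h.symm⟩

theorem proj₁_of_eigen {S : EndField D} {A B : D → ℝ} {p : D} (hne : A p ≠ B p)
    {a : TangentSpace (𝓡 2) p} (ha : S p a = A p • a) : proj₁ S A B p a = a := by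
  have : proj₁ S A B p a = (A p - B p)⁻¹ • (S p a - B p • a) := rfl
  rw [this, ha, ← sub_smul, smul_smul, inv_mul_cancel₀ (sub_ne_zero.2 hne), one_smul]

theorem proj₁_of_eigen' {S : EndField D} {A B : D → ℝ} {p : D}
    {b : TangentSpace (𝓡 2) p} (hb : S p b = B p • b) : proj₁ S A B p b = 0 := by
  have : proj₁ S A B p b = (A p - B p)⁻¹ • (S p b - B p • b) := rfl
  rw [this, hb, sub_self, smul_zero]

theorem θ₁_apply (S : EndField D) (A B : D → ℝ) (p : D) (v : TangentSpace (𝓡 2) p) :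
    θ₁ S A B p v = A p / (B p * (B p - A p)) * differential B p (proj₁ S A B p v) := rfl

variable [IsManifold (𝓡 2) ∞ D]

/-- Interchanging the two eigenvalue functions. -/
theorem IsDiagonalizedBy.swap {S : EndField D} {A B : D → ℝ} (h : IsDiagonalizedBy S A B) :
    IsDiagonalizedBy S B A where
  smooth_S := h.smooth_S
  smooth_A := h.smooth_B
  smooth_B := h.smooth_A
  ne p := (h.ne p).symm
  eigenbasis p := by
    obtain ⟨a, b, hab, ha, hb⟩ := h.eigenbasis p
    exact ⟨b, a, LinearIndependent.pair_symm_iff.1 hab, hb, ha⟩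

/-- `V` is an `A`-eigenvector `a` rescaled by `θ₁(a)`. This number is nonzero: `d'B` already kills
the `B`-eigenline, so it would vanish altogether if it also killed `a`. Exchanging `A` and `B`
produces the second frame vector from the same statement. -/
theorem exists_dual {S : EndField D} {A B : D → ℝ} (h : IsDiagonalizedBy S A B)
    (hinv : IsInvertible A B) (hnd : ∀ p, d' S A B B p ≠ 0) (p : D) :
    ∃ V : TangentSpace (𝓡 2) p, θ₁ S A B p V = 1 ∧ S p V = A p • V ∧
      ∀ v, proj₁ S A B p v = θ₁ S A B p v • V := by
  obtain ⟨a, b, hab, ha, hb⟩ := h.eigenbasis p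
  have hpa := proj₁_of_eigen (h.ne p) ha
  have hpb := proj₁_of_eigen' (A := A) hb
  have hθb : θ₁ S A B p b = 0 := by rw [θ₁_apply, hpb, map_zero, mul_zero]
  have hθa : θ₁ S A B p a ≠ 0 := by
    rw [θ₁_apply, hpa]
    refine mul_ne_zero (div_ne_zero (hinv p).1
      (mul_ne_zero (hinv p).2 (sub_ne_zero.2 (h.ne p).symm))) fun h0 => hnd p ?_
    ext v
    obtain ⟨c, d, rfl⟩ := exists_coords hab v
    have : d' S A B B p (c • a + d • b) = differential B p (proj₁ S A B p (c • a + d • b)) := rfl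
    rw [this, map_add, map_smul, map_smul, hpa, hpb, smul_zero, add_zero, map_smul, h0, smul_zero]
    rfl
  refine ⟨(θ₁ S A B p a)⁻¹ • a, ?_, ?_, fun v => ?_⟩
  · rw [map_smul, smul_eq_mul, inv_mul_cancel₀ hθa]
  · rw [map_smul, ha, smul_comm]
  · obtain ⟨c, d, rfl⟩ := exists_coords hab v
    rw [map_add, map_add, map_smul, map_smul, map_smul, map_smul, hpa, hpb, hθb, smul_zero,
      smul_zero, add_zero, add_zero, smul_smul, smul_eq_mul, mul_assoc, mul_inv_cancel₀ hθa,
      mul_one]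

theorem smoothFieldAt_proj₁ {S : EndField D} {A B : D → ℝ} (h : IsDiagonalizedBy S A B)
    {w : VField D} {p : D} (hw : SmoothFieldAt w p) :
    SmoothFieldAt (fun q => proj₁ S A B q (w q)) p := by
  have hA := h.smooth_A.contMDiffAt (x := p)
  have hB := h.smooth_B.contMDiffAt (x := p)
  have hS : SmoothFieldAt (fun q => S q (w q)) p :=
    ContMDiffAt.clm_bundle_apply (b := id) (E₁ := fun q : D => TangentSpace (𝓡 2) q)
      (E₂ := fun q : D => TangentSpace (𝓡 2) q) h.smooth_S.contMDiffAt hw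
  have hc : ContMDiffAt (𝓡 2) 𝓘(ℝ, ℝ) ∞ (fun q => (A q - B q)⁻¹) p :=
    (hA.sub hB).inv₀ (sub_ne_zero.2 (h.ne p))
  exact hc.smul_section (hS.sub_section (hB.smul_section hw))

/-- The pointwise choice of `V` is forced by duality, hence smooth: any smooth local field `w`
extending `V p`, projected to the eigenline and divided by `θ₁(w)`, equals `V` wherever `θ₁(w) ≠ 0`,
in particular near `p`. -/
theorem smoothFieldAt_eigen {S : EndField D} {A B : D → ℝ} (h : IsDiagonalizedBy S A B)
    (hinv : IsInvertible A B) {V : VField D} (h1 : ∀ p, θ₁ S A B p (V p) = 1)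
    (hV : ∀ p v, proj₁ S A B p v = θ₁ S A B p v • V p) (p : D) : SmoothFieldAt V p := by
  have hA := h.smooth_A.contMDiffAt (x := p)
  have hB := h.smooth_B.contMDiffAt (x := p)
  set w : VField D := FiberBundle.extend Plane (V p) with hw_def
  have hw : SmoothFieldAt w p := FiberBundle.contMDiffAt_extend (𝓡 2) Plane (V p)
  have hwp : w p = V p := FiberBundle.extend_apply_self (F := Plane) (V p)
  have hP := smoothFieldAt_proj₁ h hw
  have hθ : ContMDiffAt (𝓡 2) 𝓘(ℝ, ℝ) ∞ (fun q => θ₁ S A B q (w q)) p := by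
    have hc : ContMDiffAt (𝓡 2) 𝓘(ℝ, ℝ) ∞ (fun q => A q * (B q * (B q - A q))⁻¹) p :=
      hA.mul ((hB.mul (hB.sub hA)).inv₀
        (mul_ne_zero (hinv p).2 (sub_ne_zero.2 (h.ne p).symm)))
    exact hc.mul (ContMDiffAt.dAlong hP hB)
  have hθp : θ₁ S A B p (w p) ≠ 0 := by rw [hwp, h1]; exact one_ne_zero
  have hfin : SmoothFieldAt (fun q => (θ₁ S A B q (w q))⁻¹ • proj₁ S A B q (w q)) p :=
    (hθ.inv₀ hθp).smul_section hP
  refine ContMDiffAt.congr_of_eventuallyEq hfin ?_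
  filter_upwards [hθ.continuousAt.eventually_ne hθp] with q hq
  rw [hV, smul_smul, inv_mul_cancel₀ hq, one_smul]

/-- A frame `(V, W)` of eigenvector fields of `S` dual to the coframe `(θ₁, θ₂)`. -/
structure IsDualFrame (S : EndField D) (A B : D → ℝ) (V W : VField D) : Prop where
  smooth_V : ∀ p, SmoothFieldAt V p
  smooth_W : ∀ p, SmoothFieldAt W p
  θ₁_V : ∀ p, θ₁ S A B p (V p) = 1
  θ₁_W : ∀ p, θ₁ S A B p (W p) = 0
  θ₂_V : ∀ p, θ₂ S A B p (V p) = 0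
  θ₂_W : ∀ p, θ₂ S A B p (W p) = 1
  eigen_V : ∀ p, S p (V p) = A p • V p
  eigen_W : ∀ p, S p (W p) = B p • W p
  span : ∀ p v, v = θ₁ S A B p v • V p + θ₂ S A B p v • W p

theorem exists_dualFrame {S : EndField D} {A B : D → ℝ} (h : IsDiagonalizedBy S A B)
    (hinv : IsInvertible A B) (hnd : IsNondegenerate S A B) :
    ∃ V W : VField D, IsDualFrame S A B V W := by
  have hinv' : IsInvertible B A := fun p => (hinv p).symm
  choose V hV1 hVS hVp using exists_dual h hinv fun p => (hnd p).2
  choose W hW1 hWS hWp using exists_dual h.swap hinv' fun p => (hnd p).1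
  refine ⟨V, W, smoothFieldAt_eigen h hinv hV1 hVp, smoothFieldAt_eigen h.swap hinv' hW1 hWp, hV1,
    fun p => ?_, fun p => ?_, hW1, hVS, hWS, fun p v => ?_⟩
  · rw [θ₁_apply, proj₁_of_eigen' (hWS p), map_zero, mul_zero]
  · rw [θ₂_eq_θ₁_swap, θ₁_apply, proj₁_of_eigen' (hVS p), map_zero, mul_zero]
  · rw [θ₂_eq_θ₁_swap, ← hVp, ← hWp]
    have e1 : proj₁ S A B p v = (A p - B p)⁻¹ • (S p v - B p • v) := rfl
    have e2 : proj₁ S B A p v = (B p - A p)⁻¹ • (S p v - A p • v) := rfl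
    have hne := sub_ne_zero.2 (h.ne p)
    rw [e1, e2, ← neg_sub (A p) (B p), inv_neg, neg_smul, ← sub_eq_add_neg, ← smul_sub,
      sub_sub_sub_cancel_left, ← sub_smul, smul_smul, inv_mul_cancel₀ hne, one_smul]

variable {S : EndField D} {A B : D → ℝ} {V W : VField D}

/-- This is `θ₁(V) = 1` solved for the derivative of `B`. -/
theorem IsDualFrame.dAlong_V (hF : IsDualFrame S A B V W) (h : IsDiagonalizedBy S A B)
    (hinv : IsInvertible A B) (p : D) : dAlong V B p = B p * (B p - A p) / A p := by
  have h1 := hF.θ₁_V p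
  rw [θ₁_apply, proj₁_of_eigen (h.ne p) (hF.eigen_V p)] at h1
  have hne := sub_ne_zero.2 (h.ne p).symm
  have hA := (hinv p).1
  have hB := (hinv p).2
  change A p / (B p * (B p - A p)) * dAlong V B p = 1 at h1
  field_simp at h1 ⊢
  linear_combination h1

theorem IsDualFrame.swap (hF : IsDualFrame S A B V W) : IsDualFrame S B A W V where
  smooth_V := hF.smooth_W
  smooth_W := hF.smooth_V
  θ₁_V := hF.θ₂_W
  θ₁_W := hF.θ₂_V
  θ₂_V := hF.θ₁_W
  θ₂_W := hF.θ₁_V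
  eigen_V := hF.eigen_W
  eigen_W := hF.eigen_V
  span p v := (hF.span p v).trans (add_comm _ _)

theorem IsDualFrame.dAlong_W (hF : IsDualFrame S A B V W) (h : IsDiagonalizedBy S A B)
    (hinv : IsInvertible A B) (p : D) : dAlong W A p = A p * (A p - B p) / B p :=
  hF.swap.dAlong_V h.swap (fun p => (hinv p).symm) p

/-- The commutation rule for the derivatives along a dual frame of Type I. -/
theorem IsDualFrame.bracket (hF : IsDualFrame S A B V W) {K : D → ℝ}
    (h₁ : HasExtDeriv (θ₁ S A B) (wedge (θ₁ S A B) (θ₂ S A B)))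
    (h₂ : HasExtDeriv (θ₂ S A B) (fun p v w => K p * wedge (θ₂ S A B) (θ₁ S A B) p v w))
    {F : Type*} [NormedAddCommGroup F] [NormedSpace ℝ F] {f : D → F} {p : D}
    (hf : ContMDiffAt (𝓡 2) 𝓘(ℝ, F) ∞ f p) :
    dAlong V (dAlong W f) p - dAlong W (dAlong V f) p =
      -dAlong V f p + K p • dAlong W f p := by
  have ha : wedge (θ₁ S A B) (θ₂ S A B) p (V p) (W p) = 1 := by
    simp [wedge, hF.θ₁_V, hF.θ₁_W, hF.θ₂_V, hF.θ₂_W]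
  have hb : K p * wedge (θ₂ S A B) (θ₁ S A B) p (V p) (W p) = - K p := by
    simp [wedge, hF.θ₁_V, hF.θ₁_W, hF.θ₂_V, hF.θ₂_W]
  rw [dAlong_bracket h₁ h₂ hF.smooth_V hF.smooth_W hF.θ₁_V hF.θ₁_W hF.θ₂_V hF.θ₂_W hF.span ha hb hf,
    one_smul, neg_smul, sub_neg_eq_add]

end Frame

/-! ### Orthogonality in three-space -/

section Linear

theorem eq_zero_of_orthogonal {a b c z : E3} (ha : a ≠ 0) (hb : b ≠ 0) (hc : c ≠ 0)
    (hab : ⟪a, b⟫ = 0) (hac : ⟪a, c⟫ = 0) (hbc : ⟪b, c⟫ = 0)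
    (hza : ⟪z, a⟫ = 0) (hzb : ⟪z, b⟫ = 0) (hzc : ⟪z, c⟫ = 0) : z = 0 := by
  by_contra hz
  have hli : LinearIndependent ℝ ![z, a, b, c] := by
    refine linearIndependent_of_ne_zero_of_inner_eq_zero ?_ ?_
    · intro i; fin_cases i <;> simpa
    · intro i j hij
      fin_cases i <;> fin_cases j <;> simp_all [real_inner_comm]
  have := hli.fintype_card_le_finrank
  simp at this

/-- Expanding `v` in the orthogonal basis `a, b, c`, the nonzero `c`-component of `v` turns `z ⟂ v`
into `z ⟂ c`. -/
theorem eq_zero_of_orthogonal_of_inner {a b c v z : E3} (ha : a ≠ 0) (hb : b ≠ 0) (hc : c ≠ 0)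
    (hab : ⟪a, b⟫ = 0) (hac : ⟪a, c⟫ = 0) (hbc : ⟪b, c⟫ = 0)
    (hza : ⟪z, a⟫ = 0) (hzb : ⟪z, b⟫ = 0) (hzv : ⟪z, v⟫ = 0) (hvc : ⟪v, c⟫ ≠ 0) : z = 0 := by
  have ha' : ⟪a, a⟫ ≠ 0 := inner_self_ne_zero.2 ha
  have hb' : ⟪b, b⟫ ≠ 0 := inner_self_ne_zero.2 hb
  have hc' : ⟪c, c⟫ ≠ 0 := inner_self_ne_zero.2 hc
  have hv : v - (⟪v, a⟫ / ⟪a, a⟫) • a - (⟪v, b⟫ / ⟪b, b⟫) • b - (⟪v, c⟫ / ⟪c, c⟫) • c = 0 := by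
    have hba := (real_inner_comm a b).trans hab
    have hca := (real_inner_comm a c).trans hac
    have hcb := (real_inner_comm b c).trans hbc
    refine eq_zero_of_orthogonal ha hb hc hab hac hbc ?_ ?_ ?_ <;>
    simp only [inner_sub_left, real_inner_smul_left, hab, hac, hbc, real_inner_comm a b,
      real_inner_comm a c, real_inner_comm b c, mul_zero, sub_zero] <;>
    first
      | rw [div_mul_cancel₀ _ ha']; ring
      | rw [div_mul_cancel₀ _ hb']; ring
      | rw [div_mul_cancel₀ _ hc']; ring
  have h := congrArg (fun w => ⟪z, w⟫) hv
  simp only [inner_sub_right, real_inner_smul_right, hza, hzb, hzv, inner_zero_right, mul_zero,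
    zero_sub, sub_zero, neg_eq_zero, mul_eq_zero, div_eq_zero_iff, hvc, hc', false_or, or_self] at h
  exact eq_zero_of_orthogonal ha hb hc hab hac hbc hza hzb h

end Linear

/-! ### Leibniz rules for derivatives along a vector field -/

section Along

variable {D : Type*} [TopologicalSpace D] [ChartedSpace Plane D]
variable {F : Type*} [NormedAddCommGroup F] [NormedSpace ℝ F]

theorem dAlong_congr {V : VField D} {R : Set D} (hR : IsOpen R) {f g : D → F}
    (h : ∀ q ∈ R, f q = g q) {p : D} (hp : p ∈ R) : dAlong V f p = dAlong V g p :=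
  congrArg (fun L => L (V p))
    (differential_congr (Filter.eventually_of_mem (hR.mem_nhds hp) h))

theorem dAlong_const_of_eqOn {V : VField D} {R : Set D} (hR : IsOpen R) {f : D → F} {c : F}
    (h : ∀ q ∈ R, f q = c) {p : D} (hp : p ∈ R) : dAlong V f p = 0 :=
  (dAlong_congr hR h hp).trans (differential_const c p (V p))

theorem inner_dAlong_of_const {V : VField D} {R : Set D} (hR : IsOpen R) {f g : D → E3} {c : ℝ}
    (h : ∀ q ∈ R, ⟪f q, g q⟫ = c) {p : D} (hp : p ∈ R)
    (hf : ContMDiffAt (𝓡 2) 𝓘(ℝ, E3) ∞ f p) (hg : ContMDiffAt (𝓡 2) 𝓘(ℝ, E3) ∞ g p) :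
    ⟪f p, dAlong V g p⟫ + ⟪dAlong V f p, g p⟫ = 0 :=
  (differential_inner (hf.mdifferentiableAt (by simp)) (hg.mdifferentiableAt (by simp)) (V p)).symm.trans
    (dAlong_const_of_eqOn hR h hp)

theorem dAlong_smul {V : VField D} {f : D → ℝ} {g : D → F} {p : D}
    (hf : ContMDiffAt (𝓡 2) 𝓘(ℝ, ℝ) ∞ f p) (hg : ContMDiffAt (𝓡 2) 𝓘(ℝ, F) ∞ g p) :
    dAlong V (fun q => f q • g q) p = f p • dAlong V g p + dAlong V f p • g p :=
  differential_smul (hf.mdifferentiableAt (by simp)) (hg.mdifferentiableAt (by simp)) (V p)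

theorem dAlong_add {V : VField D} {f g : D → F} {p : D}
    (hf : ContMDiffAt (𝓡 2) 𝓘(ℝ, F) ∞ f p) (hg : ContMDiffAt (𝓡 2) 𝓘(ℝ, F) ∞ g p) :
    dAlong V (fun q => f q + g q) p = dAlong V f p + dAlong V g p :=
  differential_add (hf.mdifferentiableAt (by simp)) (hg.mdifferentiableAt (by simp)) (V p)

end Along

/-! ### Structure equations of the Gauss map -/

section Gauss

variable {D : Type*} [TopologicalSpace D] [ChartedSpace Plane D] [IsManifold (𝓡 2) ∞ D]

/-- The structure equations of the unit vector field `n` in terms of the vector fields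
`∂_V n` and `∂_W n`, for a frame with `[V, W] = -V + K W` and `∂_W K = 2 (K - 1)`. -/
structure IsGaussFrameOn (V W : VField D) (K : D → ℝ) (R : Set D) (n : D → E3) : Prop where
  smooth_V : ∀ p, SmoothFieldAt V p
  smooth_W : ∀ p, SmoothFieldAt W p
  smooth_K : ∀ p, ContMDiffAt (𝓡 2) 𝓘(ℝ, ℝ) ∞ K p
  smooth_n : ∀ p ∈ R, ContMDiffAt (𝓡 2) 𝓘(ℝ, E3) ∞ n p
  bracket : ∀ (f : D → E3) (p : D), ContMDiffAt (𝓡 2) 𝓘(ℝ, E3) ∞ f p →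
    dAlong V (dAlong W f) p - dAlong W (dAlong V f) p = -dAlong V f p + K p • dAlong W f p
  dK : ∀ p, dAlong W K p = 2 * (K p - 1)
  unit : ∀ p ∈ R, ⟪n p, n p⟫ = 1
  ne_V : ∀ p ∈ R, dAlong V n p ≠ 0
  ne_W : ∀ p ∈ R, dAlong W n p ≠ 0
  dWV : ∀ p ∈ R, dAlong W (dAlong V n) p = -dAlong W n p
  dVW : ∀ p ∈ R, dAlong V (dAlong W n) p = -dAlong V n p + (K p - 1) • dAlong W n p

/-- Rodrigues' formula, checked by pairing both sides with the orthogonal basis `n`, `V x`, `W x`.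
Orthogonality of the principal directions comes from the symmetry of the second fundamental form and
`A ≠ B`. -/
theorem IsRealizationOn.dAlong_normal {S : EndField D} {A B : D → ℝ} {V W : VField D} {K : D → ℝ}
    (hF : IsDualFrame S A B V W) (h : IsDiagonalizedBy S A B)
    (h₁ : HasExtDeriv (θ₁ S A B) (wedge (θ₁ S A B) (θ₂ S A B)))
    (h₂ : HasExtDeriv (θ₂ S A B) (fun p v w => K p * wedge (θ₂ S A B) (θ₁ S A B) p v w))
    {R : Set D} (hR : IsOpen R) {x n : D → E3} (hx : IsRealizationOn S R x n) {p : D}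
    (hp : p ∈ R) :
    dAlong V n p = (-A p) • dAlong V x p ∧ dAlong W n p = (-B p) • dAlong W x p := by
  have hxs := hx.smooth_x.contMDiffAt (hR.mem_nhds hp)
  have hns := hx.smooth_n.contMDiffAt (hR.mem_nhds hp)
  have hun : ∀ q ∈ R, ⟪n q, n q⟫ = (1 : ℝ) := fun q hq => by
    rw [real_inner_self_eq_norm_sq, hx.unit q hq, one_pow]
  have n0 : n p ≠ 0 := fun h0 => by simpa [h0] using hx.unit p hp
  have V0 : V p ≠ 0 := fun h0 => by simpa [h0] using hF.θ₁_V p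
  have W0 : W p ≠ 0 := fun h0 => by simpa [h0] using hF.θ₂_W p
  have x1 : dAlong V x p ≠ 0 := fun h0 => V0 (hx.immersion p hp (h0.trans (map_zero _).symm))
  have x2 : dAlong W x p ≠ 0 := fun h0 => W0 (hx.immersion p hp (h0.trans (map_zero _).symm))
  have nx1 : ⟪n p, dAlong V x p⟫ = 0 := hx.normal p hp _
  have nx2 : ⟪n p, dAlong W x p⟫ = 0 := hx.normal p hp _
  have nn : ∀ U : VField D, ⟪dAlong U n p, n p⟫ = 0 := fun U => by
    have := inner_dAlong_of_const (V := U) hR hun hp hns hns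
    rw [real_inner_comm] at this
    linarith
  -- The bracket of `V` and `W` on `x` is tangent; pairing it with `n` gives the symmetry of the
  -- second fundamental form.
  have hbr := congrArg (fun z => ⟪n p, z⟫) (hF.bracket h₁ h₂ hxs)
  have e1 := inner_dAlong_of_const (V := V) hR (fun q hq => hx.normal q hq (W q)) hp hns
    (ContMDiffAt.dAlong (hF.smooth_W p) hxs)
  have e2 := inner_dAlong_of_const (V := W) hR (fun q hq => hx.normal q hq (V q)) hp hns
    (ContMDiffAt.dAlong (hF.smooth_V p) hxs)
  change ⟪n p, dAlong V (dAlong W x) p⟫ + ⟪dAlong V n p, dAlong W x p⟫ = 0 at e1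
  change ⟪n p, dAlong W (dAlong V x) p⟫ + ⟪dAlong W n p, dAlong V x p⟫ = 0 at e2
  simp only [inner_sub_right, inner_add_right, inner_neg_right, real_inner_smul_right, nx1, nx2]
    at hbr
  have shape : ∀ (U U' : VField D) (c : ℝ), S p (U' p) = c • U' p →
      ⟪dAlong U n p, dAlong U' x p⟫ = -(c * ⟪dAlong U x p, dAlong U' x p⟫) := by
    intro U U' c hU'
    have := hx.shape p hp (U p) (U' p)
    rw [hU'] at this
    simp only [secondForm, firstForm, map_smul, real_inner_smul_right] at this
    change -⟪dAlong U n p, dAlong U' x p⟫ = c * ⟪dAlong U x p, dAlong U' x p⟫ at this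
    linarith
  have s11 := shape V V _ (hF.eigen_V p)
  have s12 := shape V W _ (hF.eigen_W p)
  have s21 := shape W V _ (hF.eigen_V p)
  have s22 := shape W W _ (hF.eigen_W p)
  have hperp : ⟪dAlong V x p, dAlong W x p⟫ = 0 := by
    have hc := real_inner_comm (dAlong V x p) (dAlong W x p)
    have : (A p - B p) * ⟪dAlong V x p, dAlong W x p⟫ = 0 := by
      rw [hc] at s21
      linarith
    exact (mul_eq_zero.1 this).resolve_left (sub_ne_zero.2 (h.ne p))
  have hperp' : ⟪dAlong W x p, dAlong V x p⟫ = 0 := (real_inner_comm _ _).trans hperp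
  have nx1' : ⟪dAlong V x p, n p⟫ = 0 := (real_inner_comm _ _).trans nx1
  have nx2' : ⟪dAlong W x p, n p⟫ = 0 := (real_inner_comm _ _).trans nx2
  constructor <;>
  · rw [← sub_eq_zero]
    refine eq_zero_of_orthogonal n0 x1 x2 nx1 nx2 hperp ?_ ?_ ?_ <;>
    simp only [inner_sub_left, real_inner_smul_left, nn, nx1', nx2', hperp, hperp', s11, s12, s21,
      s22] <;> ring

theorem IsRealizationOn.isGaussFrameOn {S : EndField D} {A B : D → ℝ} {V W : VField D} {K : D → ℝ}
    (hF : IsDualFrame S A B V W) (h : IsDiagonalizedBy S A B) (hinv : IsInvertible A B)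
    (hK : ContMDiff (𝓡 2) 𝓘(ℝ, ℝ) ∞ K)
    (h₁ : HasExtDeriv (θ₁ S A B) (wedge (θ₁ S A B) (θ₂ S A B)))
    (h₂ : HasExtDeriv (θ₂ S A B) (fun p v w => K p * wedge (θ₂ S A B) (θ₁ S A B) p v w))
    {K' : D → ℝ}
    (hdK : ∀ p, differential K p = K' p • θ₁ S A B p + (2 * (K p - 1)) • θ₂ S A B p)
    {R : Set D} (hR : IsOpen R) {x n : D → E3} (hx : IsRealizationOn S R x n) :
    IsGaussFrameOn V W K R n := by
  have hxs := fun p (hp : p ∈ R) => hx.smooth_x.contMDiffAt (hR.mem_nhds hp)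
  have hns := fun p (hp : p ∈ R) => hx.smooth_n.contMDiffAt (hR.mem_nhds hp)
  have hbr : ∀ (f : D → E3) (p : D), ContMDiffAt (𝓡 2) 𝓘(ℝ, E3) ∞ f p →
      dAlong V (dAlong W f) p - dAlong W (dAlong V f) p = -dAlong V f p + K p • dAlong W f p :=
    fun f p hf => hF.bracket h₁ h₂ hf
  have hN := fun p (hp : p ∈ R) => hx.dAlong_normal hF h h₁ h₂ hR hp
  -- Codazzi argument: the commutation rule on `n`, rewritten through `x`, and the rule on `x`
  -- itself are two linear relations between `V W x` and `W V x`. They determine both, and `K`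
  -- cancels from the result.
  have key : ∀ p ∈ R, dAlong W (dAlong V n) p = -dAlong W n p := by
    intro p hp
    have hA := h.smooth_A.contMDiffAt (x := p)
    have hB := h.smooth_B.contMDiffAt (x := p)
    have e1 : dAlong W (dAlong V n) p =
        -(A p • dAlong W (dAlong V x) p + dAlong W A p • dAlong V x p) := by
      rw [dAlong_congr hR (fun q hq => (hN q hq).1) hp,
        dAlong_smul hA.neg (ContMDiffAt.dAlong (hF.smooth_V p) (hxs p hp))]
      have : dAlong W (fun q => -A q) p = -dAlong W A p :=
        congrArg (fun L : TangentSpace (𝓡 2) p →L[ℝ] ℝ => L (W p))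
          (mfderiv_neg (I := 𝓡 2) (f := A) (x := p))
      rw [this]
      module
    have e2 : dAlong V (dAlong W n) p =
        -(B p • dAlong V (dAlong W x) p + dAlong V B p • dAlong W x p) := by
      rw [dAlong_congr hR (fun q hq => (hN q hq).2) hp,
        dAlong_smul hB.neg (ContMDiffAt.dAlong (hF.smooth_W p) (hxs p hp))]
      have : dAlong V (fun q => -B q) p = -dAlong V B p :=
        congrArg (fun L : TangentSpace (𝓡 2) p →L[ℝ] ℝ => L (V p))
          (mfderiv_neg (I := 𝓡 2) (f := B) (x := p))
      rw [this]
      module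
    have b1 := hbr x p (hxs p hp)
    have b2 := hbr n p (hns p hp)
    rw [(hN p hp).1, (hN p hp).2, e1, e2] at b2
    rw [e1, (hN p hp).2]
    rw [hF.dAlong_V h hinv] at b2
    rw [hF.dAlong_W h hinv] at b2 ⊢
    have hne := sub_ne_zero.2 (h.ne p)
    have hA0 := (hinv p).1
    have hB0 := (hinv p).2
    rw [← sub_eq_zero]
    generalize dAlong V (dAlong W x) p = Q at *
    generalize dAlong W (dAlong V x) p = P at *
    -- After eliminating `V W x` the unknown `W V x` appears with coefficient `A - B`, so the
    -- identity is proved multiplied by this factor.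
    refine (smul_eq_zero.1 (?_ : (A p - B p) • _ = (0 : E3))).resolve_left hne
    have hQ : Q = P - dAlong V x p + K p • dAlong W x p := by
      rw [sub_eq_iff_eq_add] at b1
      rw [b1]; module
    subst hQ
    linear_combination (norm := skip) (-A p) • b2
    match_scalars <;> field_simp <;> ring
  refine ⟨hF.smooth_V, hF.smooth_W, fun p => hK.contMDiffAt, hns, hbr, fun p => ?_, fun p hp => ?_,
    fun p hp => ?_, fun p hp => ?_, key, fun p hp => ?_⟩
  · have := congrArg (fun L => L (W p)) (hdK p)
    change dAlong W K p = K' p * θ₁ S A B p (W p) + (2 * (K p - 1)) * θ₂ S A B p (W p) at this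
    rw [this, hF.θ₁_W, hF.θ₂_W]
    ring
  · rw [real_inner_self_eq_norm_sq, hx.unit p hp, one_pow]
  · rw [(hN p hp).1]
    refine smul_ne_zero (neg_ne_zero.2 (hinv p).1) fun h0 => ?_
    have V0 : V p = 0 := hx.immersion p hp (h0.trans (map_zero _).symm)
    simpa [V0] using hF.θ₁_V p
  · rw [(hN p hp).2]
    refine smul_ne_zero (neg_ne_zero.2 (hinv p).2) fun h0 => ?_
    have W0 : W p = 0 := hx.immersion p hp (h0.trans (map_zero _).symm)
    simpa [W0] using hF.θ₂_W p
  · have := hbr n p (hns p hp)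
    rw [key p hp, sub_eq_iff_eq_add] at this
    rw [this]
    module

end Gauss

/-! ### The center and axis vectors of the circles -/

section Axis

variable {D : Type*} [TopologicalSpace D] [ChartedSpace Plane D]

/-- The vector `∂_W n + ∂_W ∂_W n`, which points along the axis of the family of circles. -/
def axisVector (W : VField D) (n : D → E3) : D → E3 := fun p =>
  dAlong W n p + dAlong W (dAlong W n) p

/-- The center `n + ∂_V n` (up to normalization) of the circle. -/
def centerVector (V : VField D) (n : D → E3) : D → E3 := fun p => n p + dAlong V n p

variable [IsManifold (𝓡 2) ∞ D]

namespace IsGaussFrameOn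

variable {V W : VField D} {K : D → ℝ} {R : Set D} {n : D → E3}

theorem smooth_dV (hG : IsGaussFrameOn V W K R n) {p : D} (hp : p ∈ R) :
    ContMDiffAt (𝓡 2) 𝓘(ℝ, E3) ∞ (dAlong V n) p :=
  ContMDiffAt.dAlong (hG.smooth_V p) (hG.smooth_n p hp)

theorem smooth_dW (hG : IsGaussFrameOn V W K R n) {p : D} (hp : p ∈ R) :
    ContMDiffAt (𝓡 2) 𝓘(ℝ, E3) ∞ (dAlong W n) p :=
  ContMDiffAt.dAlong (hG.smooth_W p) (hG.smooth_n p hp)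

theorem smooth_dWW (hG : IsGaussFrameOn V W K R n) {p : D} (hp : p ∈ R) :
    ContMDiffAt (𝓡 2) 𝓘(ℝ, E3) ∞ (dAlong W (dAlong W n)) p :=
  ContMDiffAt.dAlong (hG.smooth_W p) (hG.smooth_dW hp)

theorem smooth_axisVector (hG : IsGaussFrameOn V W K R n) {p : D} (hp : p ∈ R) :
    ContMDiffAt (𝓡 2) 𝓘(ℝ, E3) ∞ (axisVector W n) p :=
  (hG.smooth_dW hp).add (hG.smooth_dWW hp)

theorem smooth_centerVector (hG : IsGaussFrameOn V W K R n) {p : D} (hp : p ∈ R) :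
    ContMDiffAt (𝓡 2) 𝓘(ℝ, E3) ∞ (centerVector V n) p :=
  (hG.smooth_n p hp).add (hG.smooth_dV hp)

theorem inner_dAlong (hG : IsGaussFrameOn V W K R n) (hR : IsOpen R) (U : VField D) {p : D}
    (hp : p ∈ R) : ⟪n p, dAlong U n p⟫ = 0 := by
  have := inner_dAlong_of_const (V := U) hR hG.unit hp (hG.smooth_n p hp) (hG.smooth_n p hp)
  rw [real_inner_comm (n p)] at this
  linarith

theorem inner_dV_dW (hG : IsGaussFrameOn V W K R n) (hR : IsOpen R) {p : D} (hp : p ∈ R) :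
    ⟪dAlong V n p, dAlong W n p⟫ = 0 := by
  have := inner_dAlong_of_const (V := W) hR (fun q hq => hG.inner_dAlong hR V hq) hp
    (hG.smooth_n p hp) (hG.smooth_dV hp)
  rw [hG.dWV p hp, inner_neg_right, hG.inner_dAlong hR W hp, real_inner_comm] at this
  linarith

theorem dW_centerVector (hG : IsGaussFrameOn V W K R n) {p : D} (hp : p ∈ R) :
    dAlong W (centerVector V n) p = 0 := by
  unfold centerVector
  rw [dAlong_add (hG.smooth_n p hp) (hG.smooth_dV hp), hG.dWV p hp, add_neg_cancel]

theorem inner_centerVector (hG : IsGaussFrameOn V W K R n) (hR : IsOpen R) {p : D} (hp : p ∈ R) :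
    ⟪centerVector V n p, n p⟫ = 1 := by
  rw [centerVector, inner_add_left, hG.unit p hp, real_inner_comm, hG.inner_dAlong hR V hp, add_zero]

theorem one_lt_norm_centerVector (hG : IsGaussFrameOn V W K R n) (hR : IsOpen R) {p : D}
    (hp : p ∈ R) : 1 < ‖centerVector V n p‖ := by
  have h : ‖centerVector V n p‖ ^ 2 = 1 + ‖dAlong V n p‖ ^ 2 := by
    rw [← real_inner_self_eq_norm_sq, ← real_inner_self_eq_norm_sq, centerVector, inner_add_left,
      inner_add_right, inner_add_right, hG.unit p hp, real_inner_comm (n p),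
      hG.inner_dAlong hR V hp]
    ring
  have h2 := norm_pos_iff.2 (hG.ne_V p hp)
  nlinarith [norm_nonneg (centerVector V n p)]

theorem inner_centerVector_dW (hG : IsGaussFrameOn V W K R n) (hR : IsOpen R) {p : D}
    (hp : p ∈ R) : ⟪centerVector V n p, dAlong W n p⟫ = 0 := by
  rw [centerVector, inner_add_left, hG.inner_dAlong hR W hp, hG.inner_dV_dW hR hp, add_zero]

theorem inner_centerVector_dWW (hG : IsGaussFrameOn V W K R n) (hR : IsOpen R) {p : D}
    (hp : p ∈ R) : ⟪centerVector V n p, dAlong W (dAlong W n) p⟫ = 0 := by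
  have := inner_dAlong_of_const (V := W) hR (fun q hq => hG.inner_centerVector_dW hR hq) hp
    (hG.smooth_centerVector hp) (hG.smooth_dW hp)
  rwa [hG.dW_centerVector hp, inner_zero_left, add_zero] at this

theorem inner_centerVector_axisVector (hG : IsGaussFrameOn V W K R n) (hR : IsOpen R) {p : D}
    (hp : p ∈ R) : ⟪centerVector V n p, axisVector W n p⟫ = 0 := by
  rw [axisVector, inner_add_right, hG.inner_centerVector_dW hR hp,
    hG.inner_centerVector_dWW hR hp, add_zero]

theorem inner_centerVector_dW_axisVector (hG : IsGaussFrameOn V W K R n) (hR : IsOpen R) {p : D}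
    (hp : p ∈ R) : ⟪centerVector V n p, dAlong W (axisVector W n) p⟫ = 0 := by
  have := inner_dAlong_of_const (V := W) hR
    (fun q hq => hG.inner_centerVector_axisVector hR hq) hp
    (hG.smooth_centerVector hp) (hG.smooth_axisVector hp)
  rwa [hG.dW_centerVector hp, inner_zero_left, add_zero] at this

/-- Apply the bracket relation to `C = n + V n`: since `W C = 0`, only `-W V C = -V C` survives. -/
theorem dW_dV_centerVector (hG : IsGaussFrameOn V W K R n) (hR : IsOpen R) {p : D} (hp : p ∈ R) :
    dAlong W (dAlong V (centerVector V n)) p = dAlong V (centerVector V n) p := by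
  have := hG.bracket _ p (hG.smooth_centerVector hp)
  rw [dAlong_const_of_eqOn hR (fun q hq => hG.dW_centerVector hq) hp, hG.dW_centerVector hp,
    smul_zero, add_zero, zero_sub, neg_inj] at this
  exact this

/-- Differentiate `C ⟂ W n` along `V`. Since the value is nonzero while `C ⟂ W n`, the vectors `C`
and `V C` are independent. -/
theorem inner_dV_centerVector_dW (hG : IsGaussFrameOn V W K R n) (hR : IsOpen R) {p : D}
    (hp : p ∈ R) :
    ⟪dAlong V (centerVector V n) p, dAlong W n p⟫ = ⟪dAlong V n p, dAlong V n p⟫ := by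
  have h := inner_dAlong_of_const (V := V) hR (fun q hq => hG.inner_centerVector_dW hR hq) hp
    (hG.smooth_centerVector hp) (hG.smooth_dW hp)
  have h1 : ⟪centerVector V n p, dAlong V n p⟫ = ⟪dAlong V n p, dAlong V n p⟫ := by
    rw [centerVector, inner_add_left, hG.inner_dAlong hR V hp, zero_add]
  rw [hG.dVW p hp, inner_add_right, inner_neg_right, real_inner_smul_right, h1,
    hG.inner_centerVector_dW hR hp] at h
  linarith

/-- Differentiate `⟪V C, W n⟫ = ⟪V n, V n⟫` along `W`. By `W V C = V C` the left side becomes `⟪V C,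
W W n + W n⟫`, and the right side is `-2 ⟪V n, W n⟫ = 0`. This is where the combination defining
`axisVector` comes from. -/
theorem inner_dV_centerVector_axisVector (hG : IsGaussFrameOn V W K R n) (hR : IsOpen R) {p : D}
    (hp : p ∈ R) : ⟪dAlong V (centerVector V n) p, axisVector W n p⟫ = 0 := by
  have hsV := ContMDiffAt.dAlong (hG.smooth_V p) (hG.smooth_centerVector hp)
  have h := dAlong_congr (V := W) hR (fun q hq => hG.inner_dV_centerVector_dW hR hq) hp
  have e1 : dAlong W (fun q => ⟪dAlong V (centerVector V n) q, dAlong W n q⟫) p = _ :=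
    differential_inner (hsV.mdifferentiableAt (by simp))
      ((hG.smooth_dW hp).mdifferentiableAt (by simp)) (W p)
  have e2 : dAlong W (fun q => ⟪dAlong V n q, dAlong V n q⟫) p = _ :=
    differential_inner ((hG.smooth_dV hp).mdifferentiableAt (by simp))
      ((hG.smooth_dV hp).mdifferentiableAt (by simp)) (W p)
  rw [e1, e2] at h
  change ⟪_, dAlong W (dAlong W n) p⟫ + ⟪dAlong W (dAlong V (centerVector V n)) p, _⟫ =
    ⟪_, dAlong W (dAlong V n) p⟫ + ⟪dAlong W (dAlong V n) p, _⟫ at h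
  rw [hG.dW_dV_centerVector hR hp, hG.dWV p hp, inner_neg_right, inner_neg_left,
    real_inner_comm (dAlong V n p), hG.inner_dV_dW hR hp] at h
  rw [axisVector, inner_add_right]
  linarith

theorem inner_dV_centerVector_dW_axisVector (hG : IsGaussFrameOn V W K R n) (hR : IsOpen R) {p : D}
    (hp : p ∈ R) : ⟪dAlong V (centerVector V n) p, dAlong W (axisVector W n) p⟫ = 0 := by
  have := inner_dAlong_of_const (V := W) hR
    (fun q hq => hG.inner_dV_centerVector_axisVector hR hq) hp
    (ContMDiffAt.dAlong (hG.smooth_V p) (hG.smooth_centerVector hp)) (hG.smooth_axisVector hp)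
  rwa [hG.dW_dV_centerVector hR hp, hG.inner_dV_centerVector_axisVector hR hp, add_zero] at this

/-- Differentiating `n ⟂ W n` along `W` shows that the product equals `-‖W n‖²`. -/
theorem inner_axisVector (hG : IsGaussFrameOn V W K R n) (hR : IsOpen R) {p : D} (hp : p ∈ R) :
    ⟪axisVector W n p, n p⟫ ≠ 0 := by
  have h := inner_dAlong_of_const (V := W) hR (fun q hq => hG.inner_dAlong hR W hq) hp
    (hG.smooth_n p hp) (hG.smooth_dW hp)
  have h1 : 0 < ⟪dAlong W n p, dAlong W n p⟫ := real_inner_self_pos.2 (hG.ne_W p hp)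
  rw [real_inner_comm, axisVector, inner_add_right, hG.inner_dAlong hR W hp]
  linarith

theorem axisVector_ne_zero (hG : IsGaussFrameOn V W K R n) (hR : IsOpen R) {p : D} (hp : p ∈ R) :
    axisVector W n p ≠ 0 := fun h => hG.inner_axisVector hR hp (by rw [h, inner_zero_left])

/-- Both `M` and `W M` lie in the orthogonal complement of the independent vectors `C` and `V C`,
which is a line. -/
theorem exists_dW_axisVector (hG : IsGaussFrameOn V W K R n) (hR : IsOpen R) {p : D}
    (hp : p ∈ R) : ∃ μ : ℝ, dAlong W (axisVector W n) p = μ • axisVector W n p := by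
  set M := axisVector W n p with hM
  set z := dAlong W (axisVector W n) p with hz
  -- The factor is read off from the components along `n`, where `M` does not vanish; the difference
  -- is then orthogonal to `n`, to `V n = C - n` and to `V C`.
  refine ⟨⟪z, n p⟫ / ⟪M, n p⟫, sub_eq_zero.1 ?_⟩
  have hMn := hG.inner_axisVector hR hp
  have n0 : n p ≠ 0 := fun h0 => by simpa [h0] using hG.unit p hp
  have hzn : ⟪z - (⟪z, n p⟫ / ⟪M, n p⟫) • M, n p⟫ = 0 := by
    rw [inner_sub_left, real_inner_smul_left, div_mul_cancel₀ _ hMn, sub_self]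
  refine eq_zero_of_orthogonal_of_inner (v := dAlong V (centerVector V n) p) n0 (hG.ne_V p hp)
    (hG.ne_W p hp) (hG.inner_dAlong hR V hp) (hG.inner_dAlong hR W hp) (hG.inner_dV_dW hR hp)
    hzn ?_ ?_ ?_
  · have hc : ⟪z - (⟪z, n p⟫ / ⟪M, n p⟫) • M, centerVector V n p⟫ = 0 := by
      rw [real_inner_comm, inner_sub_right, real_inner_smul_right,
        hG.inner_centerVector_axisVector hR hp, hG.inner_centerVector_dW_axisVector hR hp]
      ring
    rwa [centerVector, inner_add_right, hzn, zero_add] at hc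
  · rw [real_inner_comm, inner_sub_right, real_inner_smul_right,
      hG.inner_dV_centerVector_axisVector hR hp, hG.inner_dV_centerVector_dW_axisVector hR hp]
    ring
  · rw [hG.inner_dV_centerVector_dW hR hp]
    exact inner_self_ne_zero.2 (hG.ne_V p hp)

/-- Commuting `V` past `W` on `W n` gives `V M = W V W n + K W W n`. Expanding `V W n`, the term `W
K = 2 (K - 1)` is exactly what makes the coefficients of `W n` and `W W n` agree. -/
theorem dV_axisVector (hG : IsGaussFrameOn V W K R n) (hR : IsOpen R) {p : D} (hp : p ∈ R) :
    dAlong V (axisVector W n) p = (2 * K p - 1) • axisVector W n p := by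
  have hb := hG.bracket _ p (hG.smooth_dW hp)
  have h1 : dAlong W (dAlong V (dAlong W n)) p = dAlong W n p +
      ((K p - 1) • dAlong W (dAlong W n) p + (2 * (K p - 1)) • dAlong W n p) := by
    have hK1 : ContMDiffAt (𝓡 2) 𝓘(ℝ, ℝ) ∞ (fun q => K q + -1) p :=
      (hG.smooth_K p).add contMDiffAt_const
    have hc1 : ContMDiffAt (𝓡 2) 𝓘(ℝ, ℝ) ∞ (fun _ : D => (-1 : ℝ)) p := contMDiffAt_const
    have hneg : ContMDiffAt (𝓡 2) 𝓘(ℝ, E3) ∞ (fun q => (-1 : ℝ) • dAlong V n q) p :=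
      hc1.smul (hG.smooth_dV hp)
    have hKW : ContMDiffAt (𝓡 2) 𝓘(ℝ, E3) ∞ (fun q => (K q + -1) • dAlong W n q) p :=
      hK1.smul (hG.smooth_dW hp)
    have e := dAlong_congr (V := W) hR
      (fun q hq => (hG.dVW q hq).trans (show _ =
        (-1 : ℝ) • dAlong V n q + (K q + -1) • dAlong W n q by module)) hp
    rw [e, dAlong_add hneg hKW, dAlong_smul hK1 (hG.smooth_dW hp),
      dAlong_smul contMDiffAt_const (hG.smooth_dV hp),
      dAlong_add (hG.smooth_K p) contMDiffAt_const, hG.dK, hG.dWV p hp]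
    have hc : ∀ c : ℝ, dAlong W (fun _ : D => c) p = 0 := fun c => differential_const c p (W p)
    rw [hc]
    module
  have h2 : dAlong V (axisVector W n) p =
      dAlong V (dAlong W n) p + dAlong V (dAlong W (dAlong W n)) p :=
    dAlong_add (hG.smooth_dW hp) (hG.smooth_dWW hp)
  rw [h1, sub_eq_iff_eq_add] at hb
  rw [h2, hb, axisVector]
  module

end IsGaussFrameOn

end Axis

/-! ### Functions and directions constant on connected open sets -/

section Constancy

variable {D : Type*} [TopologicalSpace D] [ChartedSpace Plane D] [IsManifold (𝓡 2) ∞ D]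
variable {F : Type*} [NormedAddCommGroup F] [NormedSpace ℝ F]

theorem eventually_eq_of_differential_eq_zero {R : Set D} (hR : IsOpen R) {f : D → F}
    (hf : ∀ p ∈ R, MDifferentiableAt (𝓡 2) 𝓘(ℝ, F) f p) (h : ∀ p ∈ R, differential f p = 0)
    {p : D} (hp : p ∈ R) : ∀ᶠ q in 𝓝 p, f q = f p := by
  have : IsManifold (𝓡 2) 1 D := .of_le (n := ∞) (by simp)
  set e := chartAt Plane p
  have he : e ∈ atlas Plane D := chart_mem_atlas Plane p
  have hpe : p ∈ e.source := mem_chart_source Plane p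
  have hU : IsOpen (e.target ∩ e.symm ⁻¹' R) := e.isOpen_inter_preimage_symm hR
  have hpU : e p ∈ e.target ∩ e.symm ⁻¹' R :=
    ⟨e.map_source hpe, by rwa [mem_preimage, e.left_inv hpe]⟩
  obtain ⟨ε, hε, hball⟩ := Metric.isOpen_iff.1 hU (e p) hpU
  have hd : ∀ u ∈ Metric.ball (e p) ε, DifferentiableAt ℝ (f ∘ e.symm) u := fun u hu =>
    ((hf _ (hball hu).2).comp u (mdifferentiableAt_atlas_symm he (hball hu).1)).differentiableAt
  have hconst : ∀ u ∈ Metric.ball (e p) ε, (f ∘ e.symm) u = (f ∘ e.symm) (e p) := fun u hu =>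
    Metric.isOpen_ball.is_const_of_fderiv_eq_zero (convex_ball _ _).isPreconnected
      (fun u hu => (hd u hu).differentiableWithinAt)
      (fun u hu => by
        ext v
        rw [differential_symm_comp he (hball hu).1 (hf _ (hball hu).2), h _ (hball hu).2]
        rfl) hu (Metric.mem_ball_self hε)
  filter_upwards [(e.continuousAt hpe).preimage_mem_nhds (Metric.ball_mem_nhds (e p) hε),
    e.open_source.mem_nhds hpe] with q hq hqs
  have := hconst (e q) hq
  rwa [Function.comp_apply, Function.comp_apply, e.left_inv hqs, e.left_inv hpe] at this

theorem exists_const_of_differential_eq_zero {R : Set D} (hR : IsOpen R) (hRc : IsConnected R)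
    {f : D → F} (hf : ∀ p ∈ R, MDifferentiableAt (𝓡 2) 𝓘(ℝ, F) f p)
    (h : ∀ p ∈ R, differential f p = 0) : ∃ p₀ ∈ R, ∀ p ∈ R, f p = f p₀ := by
  obtain ⟨p₀, hp₀⟩ := hRc.nonempty
  refine ⟨p₀, hp₀, fun p hp => ?_⟩
  have : PreconnectedSpace R := isPreconnected_iff_preconnectedSpace.1 hRc.isPreconnected
  have hl : IsLocallyConstant (fun q : R => f q) :=
    (IsLocallyConstant.iff_eventually_eq _).2 fun q =>
      continuous_subtype_val.continuousAt.eventually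
        (eventually_eq_of_differential_eq_zero hR hf h q.2)
  exact hl.apply_eq_of_preconnectedSpace ⟨p, hp⟩ ⟨p₀, hp₀⟩

/-- A nowhere vanishing vector function whose derivatives are multiples of itself has constant
direction on connected open sets. -/
theorem exists_const_direction {R : Set D} (hR : IsOpen R) (hRc : IsConnected R) {M : D → E3}
    (hM : ∀ p ∈ R, ContMDiffAt (𝓡 2) 𝓘(ℝ, E3) ∞ M p) (h0 : ∀ p ∈ R, M p ≠ 0)
    (h : ∀ p ∈ R, ∀ v, ∃ μ : ℝ, differential M p v = μ • M p) :
    ∃ N : E3, ‖N‖ = 1 ∧ ∀ p ∈ R, ∃ c : ℝ, N = c • M p := by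
  set g : D → ℝ := fun q => (√⟪M q, M q⟫)⁻¹ with hg
  have hpos : ∀ p ∈ R, 0 < ⟪M p, M p⟫ := fun p hp => real_inner_self_pos.2 (h0 p hp)
  have hMd : ∀ p ∈ R, MDifferentiableAt (𝓡 2) 𝓘(ℝ, E3) M p :=
    fun p hp => (hM p hp).mdifferentiableAt (by simp)
  have hQ : ∀ p ∈ R, MDifferentiableAt (𝓡 2) 𝓘(ℝ, ℝ) (fun q => ⟪M q, M q⟫) p := fun p hp =>
    (differentiableAt_fst.inner ℝ differentiableAt_snd).mdifferentiableAt.comp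
      (g := fun z : E3 × E3 => ⟪z.1, z.2⟫) p ((hMd p hp).prodMk_space (hMd p hp))
  have hφ : ∀ p ∈ R, HasDerivAt (fun s : ℝ => (√s)⁻¹)
      (-((√⟪M p, M p⟫)⁻¹ / (2 * ⟪M p, M p⟫))) ⟪M p, M p⟫ := fun p hp => by
    have hs := Real.sqrt_pos.2 (hpos p hp)
    refine ((Real.hasDerivAt_sqrt (hpos p hp).ne').inv hs.ne').congr_deriv ?_
    have := Real.sq_sqrt (hpos p hp).le
    have h3 := (hpos p hp).ne'
    rw [this]
    field_simp
  have hgd : ∀ p ∈ R, MDifferentiableAt (𝓡 2) 𝓘(ℝ, ℝ) g p := fun p hp =>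
    (hφ p hp).differentiableAt.mdifferentiableAt.comp
      (g := fun s : ℝ => (√s)⁻¹) p (hQ p hp)
  have hgv : ∀ p ∈ R, ∀ v, differential g p v =
      -((√⟪M p, M p⟫)⁻¹ / (2 * ⟪M p, M p⟫)) * differential (fun q => ⟪M q, M q⟫) p v := by
    intro p hp v
    have := ((hφ p hp).hasFDerivAt.hasMFDerivAt.comp p (hQ p hp).hasMFDerivAt).mfderiv
    exact (congrArg (fun L : TangentSpace (𝓡 2) p →L[ℝ] ℝ => L v) this).trans (mul_comm _ _)
  -- For `dM = μ M` the derivative of `1 / ‖M‖` is `-μ / ‖M‖`, so `M / ‖M‖` has zero differential.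
  obtain ⟨p₀, hp₀, hc⟩ := exists_const_of_differential_eq_zero (f := fun q => g q • M q) hR hRc
    (fun p hp => (hgd p hp).smul (hMd p hp)) (fun p hp => by
      ext1 v
      obtain ⟨μ, hμ⟩ := h p hp v
      rw [differential_smul (hgd p hp) (hMd p hp), hgv p hp, differential_inner (hMd p hp) (hMd p hp),
        hμ, real_inner_smul_left, real_inner_smul_right]
      have h3 := (hpos p hp).ne'
      change _ = (0 : E3)
      rw [smul_smul, ← add_smul]
      refine smul_eq_zero.2 (Or.inl ?_)
      simp only [hg]
      field_simp
      ring)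
  refine ⟨g p₀ • M p₀, ?_, fun p hp => ⟨g p, (hc p hp).symm⟩⟩
  simp only [hg, real_inner_self_eq_norm_sq, Real.sqrt_sq (norm_nonneg _)]
  rw [norm_smul, norm_inv, norm_norm, inv_mul_cancel₀ (norm_ne_zero_iff.2 (h0 p₀ hp₀))]

end Constancy

/-! ### Gauss images of the principal curves of the second family -/

section Curves

variable {D : Type*} [TopologicalSpace D] [ChartedSpace Plane D]

theorem IsIntegralCurveOf.hasDerivAt_comp {F : Type*} [NormedAddCommGroup F] [NormedSpace ℝ F]
    {φ : OneForm D} {R : Set D} {γ : ℝ → D} {J : Set ℝ} (hγ : IsIntegralCurveOf φ R γ J) {f : D → F}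
    {t : ℝ} (ht : t ∈ J) (hf : MDifferentiableAt (𝓡 2) 𝓘(ℝ, F) f (γ t)) :
    HasDerivAt (f ∘ γ)
      (differential f (γ t) (mfderiv 𝓘(ℝ, ℝ) (𝓡 2) γ t (1 : ℝ))) t := by
  have hγt := (hγ.smooth.contMDiffAt (hγ.isOpen.mem_nhds ht)).mdifferentiableAt (by simp)
  have h : HasFDerivAt (f ∘ γ)
      ((differential f (γ t) : Plane →L[ℝ] F).comp (mfderiv 𝓘(ℝ, ℝ) (𝓡 2) γ t : ℝ →L[ℝ] Plane)) t :=
    (hf.hasMFDerivAt.comp t hγt.hasMFDerivAt).hasFDerivAt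
  exact h.hasDerivAt

theorem eq_of_hasDerivAt_zero {F : Type*} [NormedAddCommGroup F] [NormedSpace ℝ F] {J : Set ℝ}
    (hJ : IsOpen J) (hJc : IsConnected J) {f : ℝ → F} (h : ∀ t ∈ J, HasDerivAt f 0 t)
    {s t : ℝ} (hs : s ∈ J) (ht : t ∈ J) : f s = f t :=
  hJ.is_const_of_deriv_eq_zero hJc.isPreconnected
    (fun t ht => (h t ht).differentiableAt.differentiableWithinAt) (fun t ht => (h t ht).deriv) hs ht

variable [IsManifold (𝓡 2) ∞ D] {S : EndField D} {A B : D → ℝ} {V W : VField D} {R : Set D}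
  {γ : ℝ → D} {J : Set ℝ}

/-- The velocity is annihilated by `θ₁`, hence is a multiple of `W`, nonzero by regularity; one
factor `l` serves all functions `f`. -/
theorem IsIntegralCurveOf.exists_hasDerivAt (hγ : IsIntegralCurveOf (θ₁ S A B) R γ J)
    (hF : IsDualFrame S A B V W) {t : ℝ} (ht : t ∈ J) :
    ∃ l : ℝ, l ≠ 0 ∧ ∀ f : D → E3, MDifferentiableAt (𝓡 2) 𝓘(ℝ, E3) f (γ t) →
      HasDerivAt (f ∘ γ) (l • dAlong W f (γ t)) t := by
  obtain ⟨v, hv0, hv1, hvf⟩ : ∃ v : TangentSpace (𝓡 2) (γ t), v ≠ 0 ∧ θ₁ S A B (γ t) v = 0 ∧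
      ∀ f : D → E3, MDifferentiableAt (𝓡 2) 𝓘(ℝ, E3) f (γ t) →
        HasDerivAt (f ∘ γ) (differential f (γ t) v) t :=
    ⟨_, hγ.regular t ht, hγ.tangent t ht, fun f hf => hγ.hasDerivAt_comp ht hf⟩
  have hv := hF.span (γ t) v
  rw [hv1, zero_smul, zero_add] at hv
  refine ⟨θ₂ S A B (γ t) v, fun h0 => hv0 (by rw [hv, h0, zero_smul]), fun f hf => ?_⟩
  have := hvf f hf
  rw [hv, map_smul] at this
  exact this

variable {K : D → ℝ} {n : D → E3}

/-- The Gauss image of an integral curve of `θ₁ = 0` is an arc of a geodesic circle. -/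
theorem IsGaussFrameOn.exists_isArcOfGeodesicCircle (hG : IsGaussFrameOn V W K R n) (hR : IsOpen R)
    (hF : IsDualFrame S A B V W) (hγ : IsIntegralCurveOf (θ₁ S A B) R γ J) :
    ∃ (c : E3) (r : ℝ), IsArcOfGeodesicCircle ((n ∘ γ) '' J) c r := by
  have hn : ∀ t ∈ J, MDifferentiableAt (𝓡 2) 𝓘(ℝ, E3) n (γ t) := fun t ht =>
    (hG.smooth_n _ (hγ.mapsTo ht)).mdifferentiableAt (by simp)
  obtain ⟨t₀, ht₀⟩ := hγ.isConnected.nonempty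
  set C := centerVector V n (γ t₀) with hC
  have hconst : ∀ t ∈ J, centerVector V n (γ t) = C := fun t ht =>
    eq_of_hasDerivAt_zero hγ.isOpen hγ.isConnected (f := centerVector V n ∘ γ) (fun s hs => by
      obtain ⟨l, -, hl⟩ := hγ.exists_hasDerivAt hF hs
      have := hl _ ((hG.smooth_centerVector (hγ.mapsTo hs)).mdifferentiableAt (by simp))
      rwa [hG.dW_centerVector (hγ.mapsTo hs), smul_zero] at this) ht ht₀
  have hC1 : 1 < ‖C‖ := hG.one_lt_norm_centerVector hR (hγ.mapsTo ht₀)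
  have hC0 : ‖C‖ ≠ 0 := (zero_lt_one.trans hC1).ne'
  have hinv0 : 0 < ‖C‖⁻¹ := inv_pos.2 (zero_lt_one.trans hC1)
  have hinv1 : ‖C‖⁻¹ < 1 := inv_lt_one_of_one_lt₀ hC1
  have hc1 : ‖(‖C‖⁻¹ • C)‖ = 1 := by rw [norm_smul, norm_inv, norm_norm, inv_mul_cancel₀ hC0]
  have hcont : ContinuousOn (n ∘ γ) J := fun t ht => by
    obtain ⟨l, -, hl⟩ := hγ.exists_hasDerivAt hF ht
    exact (hl n (hn t ht)).continuousAt.continuousWithinAt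
  -- From `⟪C, n⟫ = 1` the angle between `C` and `n` has cosine `1 / ‖C‖`, which lies strictly
  -- between `0` and `1`.
  refine ⟨‖C‖⁻¹ • C, Real.arccos ‖C‖⁻¹, hc1, ⟨Real.arccos_pos.2 hinv1, ?_⟩, ?_,
    hγ.isConnected.image _ hcont, ?_⟩
  · exact (Real.arccos_lt_pi_div_two.2 hinv0).trans (by linarith [Real.pi_pos])
  · rintro _ ⟨t, ht, rfl⟩
    have hn1 : ‖n (γ t)‖ = 1 := by
      have := hG.unit _ (hγ.mapsTo ht)
      rw [real_inner_self_eq_norm_sq] at this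
      exact (pow_eq_one_iff_of_nonneg (norm_nonneg _) two_ne_zero).1 this
    refine ⟨hn1, ?_⟩
    rw [InnerProductGeometry.angle, hc1, Function.comp_apply, hn1, real_inner_smul_left,
      ← hconst t ht, hG.inner_centerVector hR (hγ.mapsTo ht), hconst t ht]
    simp
  -- A one-point image would make `n ∘ γ` locally constant, against `W n ≠ 0`.
  · by_contra hnt
    rw [not_nontrivial_iff] at hnt
    obtain ⟨l, hl0, hl⟩ := hγ.exists_hasDerivAt hF ht₀
    have h1 := hl n (hn t₀ ht₀)
    have h2 : (n ∘ γ) =ᶠ[𝓝 t₀] fun _ => (n ∘ γ) t₀ :=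
      Filter.eventually_of_mem (hγ.isOpen.mem_nhds ht₀) fun t ht =>
        hnt (mem_image_of_mem _ ht) (mem_image_of_mem _ ht₀)
    have h3 := h1.unique ((hasDerivAt_const t₀ _).congr_of_eventuallyEq h2)
    exact smul_ne_zero hl0 (hG.ne_W _ (hγ.mapsTo ht₀)) h3

/-- Every center of a geodesic circle through the Gauss image of an integral curve of `θ₁ = 0` is
orthogonal to the axis vector along the curve. -/
theorem IsGaussFrameOn.inner_center_axisVector (hG : IsGaussFrameOn V W K R n)
    (hF : IsDualFrame S A B V W) (hγ : IsIntegralCurveOf (θ₁ S A B) R γ J) {c : E3} {r : ℝ}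
    (hc : (n ∘ γ) '' J ⊆ geodesicCircle c r) (hc1 : ‖c‖ = 1) {t : ℝ} (ht : t ∈ J) :
    ⟪c, axisVector W n (γ t)⟫ = 0 := by
  have step : ∀ {f : D → E3} {a : ℝ}, (∀ t ∈ J, ⟪c, f (γ t)⟫ = a) →
      (∀ t ∈ J, MDifferentiableAt (𝓡 2) 𝓘(ℝ, E3) f (γ t)) →
      ∀ t ∈ J, ⟪c, dAlong W f (γ t)⟫ = 0 := by
    intro f a hfa hf t ht
    obtain ⟨l, hl0, hl⟩ := hγ.exists_hasDerivAt hF ht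
    have h1 : HasDerivAt (fun s => ⟪c, (f ∘ γ) s⟫) (⟪c, l • dAlong W f (γ t)⟫) t := by
      simpa using (hasDerivAt_const t c).inner ℝ (hl f (hf t ht))
    have h2 : (fun s => ⟪c, (f ∘ γ) s⟫) =ᶠ[𝓝 t] fun _ => a :=
      Filter.eventually_of_mem (hγ.isOpen.mem_nhds ht) fun s hs => hfa s hs
    have h3 := h1.unique ((hasDerivAt_const t a).congr_of_eventuallyEq h2)
    rw [real_inner_smul_right] at h3
    exact (mul_eq_zero.1 h3).resolve_left hl0
  have h0 : ∀ t ∈ J, ⟪c, n (γ t)⟫ = Real.cos r := fun t ht => by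
    obtain ⟨hn1, hang⟩ := hc (mem_image_of_mem _ ht)
    rw [← hang, InnerProductGeometry.cos_angle, hc1, hn1]
    simp
  have h1 := step h0 fun t ht => (hG.smooth_n _ (hγ.mapsTo ht)).mdifferentiableAt (by simp)
  have h2 := step h1 fun t ht => (hG.smooth_dW (hγ.mapsTo ht)).mdifferentiableAt (by simp)
  rw [axisVector, inner_add_right, h1 t ht, h2 t ht, add_zero]

end Curves

end ShapeOp

end

theorem mainTheorem7 {D : Type*} [TopologicalSpace D] [T2Space D] [ConnectedSpace D]
    [ChartedSpace Plane D] [IsManifold (𝓡 2) ∞ D]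
    (S : ShapeOp.EndField D) (A B : D → ℝ)
    (hS : ShapeOp.IsDiagonalizedBy S A B)
    (hinv : ShapeOp.IsInvertible A B)
    (hnd : ShapeOp.IsNondegenerate S A B)
    (hI : ShapeOp.FirstSystem (ShapeOp.θ₁ S A B) (ShapeOp.θ₂ S A B))
    (R : Set D) (hRo : IsOpen R) (hRc : IsConnected R)
    (x n : D → E3) (hx : ShapeOp.IsRealizationOn S R x n) :
    (∀ (γ : ℝ → D) (J : Set ℝ), ShapeOp.IsIntegralCurveOf (ShapeOp.θ₁ S A B) R γ J →
      ∃ (c : E3) (r : ℝ), ShapeOp.IsArcOfGeodesicCircle ((n ∘ γ) '' J) c r) ∧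
    ∃ N : E3, ‖N‖ = 1 ∧
      ∀ (γ : ℝ → D) (J : Set ℝ), ShapeOp.IsIntegralCurveOf (ShapeOp.θ₁ S A B) R γ J →
        ∀ (c : E3) (r : ℝ), ShapeOp.IsArcOfGeodesicCircle ((n ∘ γ) '' J) c r →
          c ∈ ShapeOp.greatCircle N := by
  obtain ⟨K, K', hK, h₁, h₂, hdK⟩ := hI
  obtain ⟨V, W, hF⟩ := ShapeOp.exists_dualFrame hS hinv hnd
  have hG := hx.isGaussFrameOn hF hS hinv hK h₁ h₂ hdK hRo
  refine ⟨fun γ J hγ => hG.exists_isArcOfGeodesicCircle hRo hF hγ, ?_⟩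
  obtain ⟨N, hN, hNM⟩ := ShapeOp.exists_const_direction hRo hRc
    (fun p hp => hG.smooth_axisVector hp) (fun p hp => hG.axisVector_ne_zero hRo hp)
    (fun p hp v => by
      obtain ⟨μ, hμ⟩ := hG.exists_dW_axisVector hRo hp
      have hV := hG.dV_axisVector hRo hp
      -- Decompose `v = θ₁(v) V + θ₂(v) W` and combine the factors of `V M` and `W M`.
      refine ⟨ShapeOp.θ₁ S A B p v * (2 * K p - 1) + ShapeOp.θ₂ S A B p v * μ, ?_⟩
      have hv := congrArg (ShapeOp.differential (ShapeOp.axisVector W n) p) (hF.span p v)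
      rw [map_add, map_smul, map_smul] at hv
      change _ = _ • ShapeOp.dAlong V _ p + _ • ShapeOp.dAlong W _ p at hv
      rw [hv, hV, hμ, smul_smul, smul_smul, add_smul])
  refine ⟨N, hN, fun γ J hγ c r hc => ⟨hc.1, ?_⟩⟩
  obtain ⟨t, ht⟩ := hγ.isConnected.nonempty
  obtain ⟨a, ha⟩ := hNM (γ t) (hγ.mapsTo ht)
  rw [ha, real_inner_smul_left, real_inner_comm,
    hG.inner_center_axisVector hF hγ hc.2.2.1 hc.1 ht, mul_zero]
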